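/- **Setting.** A *trial* consists of a finite set $S$ of sites; site $s$ has non-zero finite-dimensional input and output Hilbert spaces $\mathcal H^{s_I},\mathcal H^{s_O}$, and $\mathcal H_{\mathrm{ST}}=\bigotimes_{s\in S}\mathcal H^{s_I}\otimes\mathcal H^{s_O}$. A completely positive trace-preserving (CPTP) map $\mathcal M:\mathfrak L(\mathcal H^{s_I})\to\mathfrak L(\mathcal H^{s_O})$ is identified with its Choi–Jamiołkowski operator $\big[\sum_{jk}|j\rangle\langle k|\otimes\mathcal M(|j\rangle\langle k|)\big]^T$. A *CPTP map on a trial* is a tensor product $\overline M=\bigotimes_{s\in S}\overline M^{s}$ of CPTP maps, one for each site. An *$n$-trial process matrix* is an operator $W^{(n)}\in\mathfrak L(\mathcal H_{\mathrm{ST}}^{\otimes n})$ with $W^{(n)}\ge 0$ and $\operatorname{tr}\big[(\overline M^1\otimes\cdots\otimes\overline M^n)W^{(n)}\big]=1$ for all CPTP maps $\overline M^1,\dots,\overline M^n$ on a trial. Let $\mathfrak W$ be the set of single-trial process matrices (the case $n=1$), with its Borel $\sigma$-algebra. A sequence $(W^{(n)})_{n\ge1}$ of $n$-trial process matrices is *exchangeable*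 if for every $n\ge 1$ 1. (symmetry) $U(\sigma)W^{(n)}U(\sigma)^\dagger=W^{(n)}$ for every $\sigma\in S_n$, where $U(\sigma)=\sum_{\mu_1,\dots,\mu_n}|\mu_{\sigma(1)}\cdots\mu_{\sigma(n)}\rangle\langle\mu_1\cdots\mu_n|$ permutes the trials; 2. (process extendibility) $W^{(n)}=\operatorname{tr}_{n+1}\big[W^{(n+1)}(\mathbb 1^{\otimes n}\otimes\overline M)\big]$ for every CPTP map $\overline M$ on a trial. An $n$-trial process matrix is *exchangeable* if it is the $n$-th member of some exchangeable sequence. **Corollary (de Finetti theorem for process matrices).** (i) For every $n\ge1$, an operator $W^{(n)}\in\mathfrak L(\mathcal H_{\mathrm{ST}}^{\otimes n})$ is an exchangeable $n$-trial process matrix if and only if there is a Borel probability measure $P$ on $\mathfrak W$ with $$W^{(n)}=\int_{\mathfrak W}W^{\otimes n}\,dP(W).\tag{$*$}$$ (ii) A sequence of operators $W^{(n)}\in\mathfrak L(\mathcal H_{\mathrm{ST}}^{\otimes n})$, $n\ge1$, is an exchangeable sequence of process matrices if and only if there is a Borel probability measure $P$ on $\mathfrak W$ such that $(*)$ holds for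 all $n\ge1$ with this same $P$; and for an exchangeable sequence this $P$ is unique. -/

import Mathlib

open MeasureTheory

open scoped ComplexOrder

/-- The tensor product `⨂ i, M i` of finitely many operators, in the product basis: the space
`⨂ i, ℂ^(X i)` is `ℂ^(∀ i, X i)`, and the matrix entries are `∏ i, M i (μ i) (ν i)`. -/
def tensorOp {ι : Type*} [Fintype ι] {X : ι → Type*} (M : ∀ i, Matrix (X i) (X i) ℂ) :
    Matrix (∀ i, X i) (∀ i, X i) ℂ :=
  fun μ ν => ∏ i, M i (μ i) (ν i)

/-- The map `id_K ⊗ Φ` on operators on `ℂ^K ⊗ ℂ^A`: `Φ` acts on each `A`-block. -/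
def ampliation (K : Type*) {A B : Type*} (Φ : Matrix A A ℂ →ₗ[ℂ] Matrix B B ℂ)
    (X : Matrix (K × A) (K × A) ℂ) : Matrix (K × B) (K × B) ℂ :=
  fun p q => Φ (Matrix.of fun a a' => X (p.1, a) (q.1, a')) p.2 q.2

/-- Complete positivity: every ampliation `id_k ⊗ Φ` preserves positive semidefiniteness. -/
def IsCompletelyPositive {A B : Type*} (Φ : Matrix A A ℂ →ₗ[ℂ] Matrix B B ℂ) : Prop :=
  ∀ (k : ℕ) (X : Matrix (Fin k × A) (Fin k × A) ℂ),
    X.PosSemidef → (ampliation (Fin k) Φ X).PosSemidef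

/-- Completely positive and trace preserving maps. -/
def IsCPTP {A B : Type*} [Fintype A] [Fintype B] (Φ : Matrix A A ℂ →ₗ[ℂ] Matrix B B ℂ) : Prop :=
  IsCompletelyPositive Φ ∧ ∀ X, (Φ X).trace = X.trace

/-- The Choi-Jamiołkowski operator `[∑ j k, |j⟩⟨k| ⊗ Φ(|j⟩⟨k|)]ᵀ`, an operator on
`ℂ^A ⊗ ℂ^B` (input tensor output). -/
def choi {A B : Type*} [DecidableEq A] (Φ : Matrix A A ℂ →ₗ[ℂ] Matrix B B ℂ) :
    Matrix (A × B) (A × B) ℂ :=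
  (Matrix.of fun p q : A × B => Φ (Matrix.single p.1 q.1 1) p.2 q.2).transpose

/-- Basis of the single-trial space `H_ST = ⨂ s, (ℂ^(I s) ⊗ ℂ^(O s))`, where `s` ranges over the
sites of a trial and `I s`, `O s` index bases of the input and output spaces of site `s`. -/
abbrev TrialIndex {S : Type*} (I O : S → Type*) : Type _ := ∀ s, I s × O s

section Processes

variable {S : Type*} [Fintype S] (I O : S → Type*)
  [∀ s, Fintype (I s)] [∀ s, Fintype (O s)] [∀ s, DecidableEq (I s)]

/-- The CJ operators `M^A ⊗ M^B ⊗ ⋯` of the deterministic operations on one trial: one CPTP map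
at each site. -/
def deterministicOps : Set (Matrix (TrialIndex I O) (TrialIndex I O) ℂ) :=
  {M | ∃ Φ : ∀ s, Matrix (I s) (I s) ℂ →ₗ[ℂ] Matrix (O s) (O s) ℂ,
    (∀ s, IsCPTP (Φ s)) ∧ M = tensorOp fun s => choi (Φ s)}

variable [DecidableEq S]

/-- Single-trial process matrices: `W ≥ 0` and `tr[(M^A ⊗ M^B ⊗ ⋯) W] = 1` for all CPTP maps at
the sites. -/
def IsProcessMatrix (W : Matrix (TrialIndex I O) (TrialIndex I O) ℂ) : Prop :=
  W.PosSemidef ∧ ∀ M ∈ deterministicOps I O, (M * W).trace = 1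

/-- `n`-trial process matrices: the same two conditions for the `n * |S|` sites of `n` trials. -/
def IsTrialProcessMatrix (n : ℕ)
    (W : Matrix (Fin n → TrialIndex I O) (Fin n → TrialIndex I O) ℂ) : Prop :=
  W.PosSemidef ∧
    ∀ M : Fin n → Matrix (TrialIndex I O) (TrialIndex I O) ℂ,
      (∀ j, M j ∈ deterministicOps I O) → (tensorOp M * W).trace = 1

/-- The set `𝔚` of single-trial process matrices, as a space. -/
abbrev ProcessMatrix : Type _ :=
  {W : Matrix (TrialIndex I O) (TrialIndex I O) ℂ // IsProcessMatrix I O W}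

/-- `𝔚` carries the Borel σ-algebra of its usual topology (entrywise convergence). -/
noncomputable instance : MeasurableSpace (ProcessMatrix I O) := borel _

instance : BorelSpace (ProcessMatrix I O) := ⟨rfl⟩

end Processes

section Trials

variable {T : Type*} [Fintype T] [DecidableEq T]

/-- `U(σ) = ∑ |μ_{σ(1)} … μ_{σ(n)}⟩⟨μ_1 … μ_n|`, permuting the `n` trials. -/
def permOp (T : Type*) [DecidableEq T] {n : ℕ} (σ : Equiv.Perm (Fin n)) :
    Matrix (Fin n → T) (Fin n → T) ℂ :=
  fun ν μ => if ν = μ ∘ σ then 1 else 0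

/-- The partial trace over the last of `n + 1` trials. -/
def traceLast {n : ℕ} (X : Matrix (Fin (n + 1) → T) (Fin (n + 1) → T) ℂ) :
    Matrix (Fin n → T) (Fin n → T) ℂ :=
  fun μ ν => ∑ t : T, X (Fin.snoc (α := fun _ => T) μ t) (Fin.snoc (α := fun _ => T) ν t)

/-- `𝟙^{⊗ n} ⊗ M`, acting as `M` on the last of `n + 1` trials. -/
def onLast (n : ℕ) (M : Matrix T T ℂ) : Matrix (Fin (n + 1) → T) (Fin (n + 1) → T) ℂ :=
  tensorOp (Fin.snoc (α := fun _ => Matrix T T ℂ) (fun _ : Fin n => 1) M)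

end Trials

section Exchangeability

variable {S : Type*} [Fintype S] [DecidableEq S] (I O : S → Type*)
  [∀ s, Fintype (I s)] [∀ s, Fintype (O s)] [∀ s, DecidableEq (I s)] [∀ s, DecidableEq (O s)]

/-- `(W n)_{n ≥ 1}` is an exchangeable sequence of process matrices: it is symmetric under
permutations of trials and process-extendible. The value `W 0` plays no role. -/
def IsExchangeableSeq
    (W : ∀ n : ℕ, Matrix (Fin n → TrialIndex I O) (Fin n → TrialIndex I O) ℂ) : Prop :=
  ∀ n, 1 ≤ n →
    IsTrialProcessMatrix I O n (W n) ∧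
    (∀ σ : Equiv.Perm (Fin n),
      permOp (TrialIndex I O) σ * W n * (permOp (TrialIndex I O) σ).conjTranspose = W n) ∧
    ∀ M ∈ deterministicOps I O, W n = traceLast (W (n + 1) * onLast n M)

/-- An `n`-trial process matrix is exchangeable if it is part of an exchangeable sequence. -/
def IsExchangeable (n : ℕ)
    (Wn : Matrix (Fin n → TrialIndex I O) (Fin n → TrialIndex I O) ℂ) : Prop :=
  ∃ W : ∀ n : ℕ, Matrix (Fin n → TrialIndex I O) (Fin n → TrialIndex I O) ℂ,
    IsExchangeableSeq I O W ∧ W n = Wn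

/-- The mixture `∫ W^{⊗ n} dP(W)` over single-trial process matrices, as an entrywise integral.
The integrand is continuous and bounded (`W ≥ 0` has fixed trace `∏ s, |O s|`), so that it is
integrable. -/
noncomputable def iidMixture (P : ProbabilityMeasure (ProcessMatrix I O)) (n : ℕ) :
    Matrix (Fin n → TrialIndex I O) (Fin n → TrialIndex I O) ℂ :=
  fun μ ν => ∫ W : ProcessMatrix I O, tensorOp (fun _ : Fin n => W.1) μ ν
    ∂(P : Measure (ProcessMatrix I O))

end Exchangeability

/-! ### Products, traces and positivity of tensor product operators. -/

section TensorAlgebra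

/-! The quantum statement is reduced to the classical de Finetti theorem by an informationally
complete measurement. Choose finitely many positive operators `E k` that span all operators and sum
to `c • 1`. For `c = ∏ s, 1/|O s|` this sum is the Choi operator of the channel that depolarizes
every site, so it is a deterministic operation (`smul_one_mem_deterministicOps`). Hence the numbers
`tr[(E_{a₁} ⊗ ⋯ ⊗ E_{aₙ}) W⁽ⁿ⁾]` form consistent exchangeable probability distributions, and
`exists_probabilityMeasure_of_exchangeable` gives a measure on `[0,1]^K` having them as moments. As
the `E k` span, each point `x` yields an operator `A x`, and `W⁽ⁿ⁾ = ∫ (A x)^{⊗ n}`.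

It remains to see that `A x` is almost surely a process matrix. Every linear functional of `x`
stands for an operator, and its moments are correlations in the `W⁽ⁿ⁾`. Linear relations and
normalisation follow from vanishing second moments (`Represents.ae_eq_zero`,
`Represents.ae_eq_one`). Positivity follows from high moments: if `0 ≤ B ≤ D` with `D`
deterministic, all moments of the variables of `B` and `D - B` are at most 1, so both variables are
at most 1 in absolute value; they add up to 1, so neither is negative (`Represents.ae_nonneg`). The
measure is then pushed forward along `A`.

For uniqueness, the entries of the `W^{⊗ n}` are the monomials in the entries of `W`. With the
constants they span a star algebra that separates the points of `𝔚`, so their integrals determine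
the measure. -/

theorem tensorOp_conjTranspose {ι : Type*} [Fintype ι] {X : ι → Type*}
    (M : ∀ i, Matrix (X i) (X i) ℂ) :
    (tensorOp M).conjTranspose = tensorOp fun i => (M i).conjTranspose := by
  ext μ ν
  simp [tensorOp, Matrix.conjTranspose_apply]

theorem tensorOp_mul {ι : Type*} [Fintype ι] [DecidableEq ι] {X : ι → Type*} [∀ i, Fintype (X i)]
    (M N : ∀ i, Matrix (X i) (X i) ℂ) :
    tensorOp M * tensorOp N = tensorOp fun i => M i * N i := by
  ext μ ν
  simp only [tensorOp, Matrix.mul_apply, ← Finset.prod_mul_distrib]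
  rw [Finset.prod_univ_sum, Fintype.piFinset_univ]

theorem trace_tensorOp {ι : Type*} [Fintype ι] [DecidableEq ι] {X : ι → Type*}
    [∀ i, Fintype (X i)] (M : ∀ i, Matrix (X i) (X i) ℂ) :
    (tensorOp M).trace = ∏ i, (M i).trace := by
  simp only [Matrix.trace, tensorOp, Matrix.diag_apply]
  rw [Finset.prod_univ_sum, Fintype.piFinset_univ]

theorem Matrix.PosSemidef.exists_conjTranspose_mul_self {n : Type*} [Fintype n]
    {M : Matrix n n ℂ} (hM : M.PosSemidef) : ∃ C : Matrix n n ℂ, M = C.conjTranspose * C := by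
  classical
  open scoped MatrixOrder in
  exact CStarAlgebra.nonneg_iff_eq_star_mul_self.mp hM.nonneg

theorem posSemidef_tensorOp {ι : Type*} [Fintype ι] {X : ι → Type*}
    [∀ i, Fintype (X i)] {M : ∀ i, Matrix (X i) (X i) ℂ} (hM : ∀ i, (M i).PosSemidef) :
    (tensorOp M).PosSemidef := by
  classical
  choose C hC using fun i => (hM i).exists_conjTranspose_mul_self
  have : tensorOp M = (tensorOp C).conjTranspose * tensorOp C := by
    rw [tensorOp_conjTranspose, tensorOp_mul]
    exact congrArg _ (funext hC)
  rw [this]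
  exact Matrix.posSemidef_conjTranspose_mul_self _

theorem Matrix.PosSemidef.trace_mul_nonneg {n : Type*} [Fintype n]
    {A B : Matrix n n ℂ} (hA : A.PosSemidef) (hB : B.PosSemidef) : 0 ≤ (A * B).trace := by
  obtain ⟨C, rfl⟩ := hA.exists_conjTranspose_mul_self
  rw [Matrix.mul_assoc, Matrix.trace_mul_comm]
  exact (hB.mul_mul_conjTranspose_same C).trace_nonneg

theorem tensorOp_smul_one {ι : Type*} [Fintype ι] [DecidableEq ι] {X : ι → Type*}
    [∀ i, DecidableEq (X i)] (c : ι → ℂ) :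
    tensorOp (fun i => c i • (1 : Matrix (X i) (X i) ℂ)) = (∏ i, c i) • 1 := by
  ext μ ν
  simp only [tensorOp, Matrix.smul_apply, smul_eq_mul, Finset.prod_mul_distrib, Matrix.one_apply]
  congr 1
  by_cases h : μ = ν
  · simp [h]
  · obtain ⟨i, hi⟩ := Function.ne_iff.mp h
    rw [if_neg h]
    exact Finset.prod_eq_zero (Finset.mem_univ i) (if_neg hi)

theorem tensorOp_isHermitian {ι : Type*} [Fintype ι] {X : ι → Type*}
    {M : ∀ i, Matrix (X i) (X i) ℂ} (hM : ∀ i, (M i).IsHermitian) :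
    (tensorOp M).IsHermitian := by
  rw [Matrix.IsHermitian, tensorOp_conjTranspose]
  exact congrArg _ (funext hM)

end TensorAlgebra

/-! ### Correlations of product operators, permutations and partial traces of trials. -/

section Correlations

variable {T : Type*} [Fintype T]

/-- The value `tr[(B₁ ⊗ ⋯ ⊗ Bₙ) W]`. -/
def corr {n : ℕ} (W : Matrix (Fin n → T) (Fin n → T) ℂ) (B : Fin n → Matrix T T ℂ) : ℂ :=
  (tensorOp B * W).trace

theorem corr_eq_sum {n : ℕ} (W : Matrix (Fin n → T) (Fin n → T) ℂ)
    (B : Fin n → Matrix T T ℂ) :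
    corr W B = ∑ μ, ∑ ν, (∏ j, B j (μ j) (ν j)) * W ν μ := by
  simp [corr, Matrix.trace, Matrix.mul_apply, tensorOp]

omit [Fintype T] in
theorem tensorOp_sum_smul {n : ℕ} {K : Type*} [Fintype K] (f : Fin n → K → ℂ)
    (E : K → Matrix T T ℂ) :
    tensorOp (fun j => ∑ k, f j k • E k) =
      ∑ κ : Fin n → K, (∏ j, f j (κ j)) • tensorOp (fun j => E (κ j)) := by
  classical
  ext μ ν
  simp only [tensorOp, Matrix.sum_apply, Matrix.smul_apply, smul_eq_mul]
  rw [Finset.prod_univ_sum, Fintype.piFinset_univ]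
  simp only [Finset.prod_mul_distrib]

theorem corr_sum_smul {n : ℕ} {K : Type*} [Fintype K]
    (W : Matrix (Fin n → T) (Fin n → T) ℂ) (f : Fin n → K → ℂ) (E : K → Matrix T T ℂ) :
    corr W (fun j => ∑ k, f j k • E k) =
      ∑ κ : Fin n → K, (∏ j, f j (κ j)) * corr W (fun j => E (κ j)) := by
  simp [corr, tensorOp_sum_smul, Finset.sum_mul, Matrix.trace_sum]

theorem corr_nonneg {n : ℕ} {W : Matrix (Fin n → T) (Fin n → T) ℂ} (hW : W.PosSemidef)
    {B : Fin n → Matrix T T ℂ} (hB : ∀ j, (B j).PosSemidef) : 0 ≤ corr W B :=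
  (posSemidef_tensorOp hB).trace_mul_nonneg hW

theorem corr_eq_zero {n : ℕ} (W : Matrix (Fin n → T) (Fin n → T) ℂ)
    {B : Fin n → Matrix T T ℂ} {j : Fin n} (hB : B j = 0) : corr W B = 0 := by
  rw [corr_eq_sum]
  refine Finset.sum_eq_zero fun μ _ => Finset.sum_eq_zero fun ν _ => ?_
  rw [Finset.prod_eq_zero (Finset.mem_univ j) (by simp [hB]), zero_mul]

variable [DecidableEq T]

/-- An operator is determined by its product correlations; the indices are transposed because
`tr(|ν⟩⟨μ| W)` is the `(μ, ν)` entry. -/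
theorem corr_single {n : ℕ} (W : Matrix (Fin n → T) (Fin n → T) ℂ) (μ ν : Fin n → T) :
    corr W (fun j => Matrix.single (ν j) (μ j) 1) = W μ ν := by
  have key : ∀ α β : Fin n → T,
      (∏ j, Matrix.single (ν j) (μ j) (1 : ℂ) (α j) (β j)) =
        if ν = α then if μ = β then 1 else 0 else 0 := by
    intro α β
    by_cases h1 : ν = α
    · by_cases h2 : μ = β
      · simp [h1, h2]
      · obtain ⟨i, hi⟩ := Function.ne_iff.mp h2
        rw [if_pos h1, if_neg h2]
        exact Finset.prod_eq_zero (Finset.mem_univ i) (by simp [hi])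
    · obtain ⟨i, hi⟩ := Function.ne_iff.mp h1
      rw [if_neg h1]
      exact Finset.prod_eq_zero (Finset.mem_univ i) (by simp [hi])
  simp [corr_eq_sum, key, ite_mul]

theorem permOp_conj_apply {n : ℕ} (σ : Equiv.Perm (Fin n))
    (W : Matrix (Fin n → T) (Fin n → T) ℂ) (μ ν : Fin n → T) :
    (permOp T σ * W * (permOp T σ).conjTranspose) (μ ∘ σ) (ν ∘ σ) = W μ ν := by
  have h : ∀ α β : Fin n → T, (α ∘ σ = β ∘ σ) ↔ α = β := fun α β =>
    σ.surjective.injective_comp_right.eq_iff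
  simp [Matrix.mul_apply, permOp, h, Matrix.conjTranspose_apply, apply_ite]

theorem corr_comp_perm {n : ℕ} {W : Matrix (Fin n → T) (Fin n → T) ℂ}
    (hW : ∀ σ : Equiv.Perm (Fin n), permOp T σ * W * (permOp T σ).conjTranspose = W)
    (B : Fin n → Matrix T T ℂ) (σ : Equiv.Perm (Fin n)) :
    corr W (B ∘ σ) = corr W B := by
  rw [corr_eq_sum, corr_eq_sum]
  symm
  refine Fintype.sum_equiv (σ.symm.arrowCongr (Equiv.refl T)) _ _ fun μ => ?_
  refine Fintype.sum_equiv (σ.symm.arrowCongr (Equiv.refl T)) _ _ fun ν => ?_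
  have h : ∀ α : Fin n → T, σ.symm.arrowCongr (Equiv.refl T) α = α ∘ σ := fun α => rfl
  rw [h, h]
  congr 1
  · exact (Equiv.prod_comp σ fun j => B j (μ j) (ν j)).symm
  · conv_rhs => rw [← hW σ]
    exact (permOp_conj_apply σ W ν μ).symm

omit [DecidableEq T] in
theorem sum_snoc {n : ℕ} {M : Type*} [AddCommMonoid M] (f : (Fin (n + 1) → T) → M) :
    ∑ μ, f μ = ∑ μ : Fin n → T, ∑ t, f (Fin.snoc (α := fun _ => T) μ t) := by
  rw [← Fintype.sum_prod_type', ← Equiv.sum_comp (Equiv.prodComm _ _)]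
  symm
  exact Fintype.sum_equiv (Fin.snocEquiv fun _ => T) _ _ fun p => rfl

omit [Fintype T] [DecidableEq T] in
theorem tensorOp_snoc {n : ℕ} (B : Fin n → Matrix T T ℂ) (M : Matrix T T ℂ)
    (μ ν : Fin n → T) (s t : T) :
    tensorOp (Fin.snoc (α := fun _ => Matrix T T ℂ) B M) (Fin.snoc (α := fun _ => T) μ s)
      (Fin.snoc (α := fun _ => T) ν t) = tensorOp B μ ν * M s t := by
  simp [tensorOp, Fin.prod_univ_castSucc]

omit [Fintype T] in
theorem tensorOp_one {n : ℕ} :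
    tensorOp (fun _ : Fin n => (1 : Matrix T T ℂ)) = 1 := by
  simpa using tensorOp_smul_one (X := fun _ : Fin n => T) (fun _ => 1)

theorem traceLast_mul_onLast_apply {n : ℕ}
    (Y : Matrix (Fin (n + 1) → T) (Fin (n + 1) → T) ℂ) (M : Matrix T T ℂ) (μ ν : Fin n → T) :
    traceLast (Y * onLast n M) μ ν =
      ∑ t, ∑ s, Y (Fin.snoc (α := fun _ => T) μ t) (Fin.snoc (α := fun _ => T) ν s) * M s t := by
  simp only [traceLast, Matrix.mul_apply, sum_snoc, onLast, tensorOp_snoc, tensorOp_one,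
    Matrix.one_apply]
  simp

/-- Process extendibility thereby becomes marginalisation: inserting a deterministic operation in
the last trial removes that trial. -/
theorem corr_snoc {n : ℕ} (Y : Matrix (Fin (n + 1) → T) (Fin (n + 1) → T) ℂ)
    (M : Matrix T T ℂ) (B : Fin n → Matrix T T ℂ) :
    corr Y (Fin.snoc (α := fun _ => Matrix T T ℂ) B M) =
      corr (traceLast (Y * onLast n M)) B := by
  have : ∀ (m : ℕ) (Z : Matrix (Fin m → T) (Fin m → T) ℂ) (C : Fin m → Matrix T T ℂ),
      corr Z C = ∑ μ, ∑ ν, tensorOp C μ ν * Z ν μ := fun m Z C => corr_eq_sum Z C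
  simp only [this, traceLast_mul_onLast_apply, sum_snoc, tensorOp_snoc, Finset.mul_sum]
  refine Finset.sum_congr rfl fun μ _ => ?_
  rw [Finset.sum_comm]
  refine Finset.sum_congr rfl fun ν _ => ?_
  rw [Finset.sum_comm]
  refine Finset.sum_congr rfl fun s _ => Finset.sum_congr rfl fun t _ => ?_
  ring

end Correlations

/-! ### The classical de Finetti theorem for a finite alphabet. -/

section ClassicalDeFinetti

open Filter Topology

theorem card_injective (n N : ℕ) :
    ((Finset.univ.filter fun i : Fin n → Fin N => Function.Injective i).card) =
      N.descFactorial n := by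
  rw [← Fintype.card_subtype, Fintype.card_congr (Equiv.subtypeInjectiveEquivEmbedding _ _),
    Fintype.card_embedding_eq]
  simp

/-- The ratio is the probability that `n` draws with replacement from `N` positions are distinct. -/
theorem tendsto_descFactorial_div_pow (n : ℕ) :
    Tendsto (fun N : ℕ => (N.descFactorial n : ℝ) / (N : ℝ) ^ n) atTop (𝓝 1) := by
  refine (Asymptotics.isEquivalent_iff_tendsto_one ?_).mp (isEquivalent_descFactorial n)
  filter_upwards [eventually_gt_atTop 0] with N hN
  positivity

variable {K : Type*} [Fintype K] [DecidableEq K]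

/-- The empirical frequencies of a word of length `N`, as a point of the cube `[0,1]^K`. -/
noncomputable def frequency {N : ℕ} (κ : Fin N → K) : K → Set.Icc (0 : ℝ) 1 := fun k =>
  ⟨(∑ l, if κ l = k then 1 else 0) / N, by positivity, by
    refine div_le_one_of_le₀ ?_ (Nat.cast_nonneg N)
    refine (Finset.sum_le_sum (g := fun _ => (1 : ℝ)) fun l _ => ?_).trans (by simp)
    split_ifs <;> norm_num⟩

/-- The distribution of the empirical frequencies of a random word with weights `p`. -/
noncomputable def empirical {N : ℕ} (p : (Fin N → K) → ℝ) : Measure (K → Set.Icc (0 : ℝ) 1) :=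
  ∑ κ, ENNReal.ofReal (p κ) • Measure.dirac (frequency κ)

theorem isProbabilityMeasure_empirical {N : ℕ} {p : (Fin N → K) → ℝ} (hp : ∀ κ, 0 ≤ p κ)
    (hsum : ∑ κ, p κ = 1) : IsProbabilityMeasure (empirical p) := by
  constructor
  simp [empirical, ← ENNReal.ofReal_sum_of_nonneg fun κ _ => hp κ, hsum]

theorem integral_empirical {N : ℕ} {p : (Fin N → K) → ℝ} (hp : ∀ κ, 0 ≤ p κ)
    {g : (K → Set.Icc (0 : ℝ) 1) → ℝ} :
    ∫ x, g x ∂(empirical p) = ∑ κ, p κ * g (frequency κ) := by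
  rw [empirical, integral_finsetSum_measure]
  · simp [integral_smul_measure, hp]
  · intro κ _
    exact (integrable_dirac (by simp)).smul_measure (by simp)

/-- A product of empirical frequencies samples letters of the word with replacement, so all position
choices `i` occur, not only the injective ones. -/
theorem integral_empirical_prod {N n : ℕ} {p : (Fin N → K) → ℝ} (hp : ∀ κ, 0 ≤ p κ)
    (a : Fin n → K) :
    ∫ x, ∏ j, (x (a j) : ℝ) ∂(empirical p) =
      (∑ i : Fin n → Fin N, ∑ κ, p κ * ∏ j, if κ (i j) = a j then 1 else 0) / (N : ℝ) ^ n := by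
  rw [integral_empirical hp, Finset.sum_comm, Finset.sum_div]
  refine Finset.sum_congr rfl fun κ _ => ?_
  simp only [frequency, Finset.prod_div_distrib, Finset.prod_const, Finset.card_univ,
    Fintype.card_fin]
  rw [Finset.prod_univ_sum, Fintype.piFinset_univ, mul_div_assoc', Finset.mul_sum]

/-- Injective position choices contribute exactly `q`; the others are off by at most 1, so the error
is at most their proportion. -/
theorem abs_integral_empirical_prod_sub_le {N n : ℕ} (hN : 1 ≤ N) {p : (Fin N → K) → ℝ}
    (hp : ∀ κ, 0 ≤ p κ) (hsum : ∑ κ, p κ = 1) {a : Fin n → K} {q : ℝ} (hq0 : 0 ≤ q)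
    (hq1 : q ≤ 1)
    (h : ∀ i : Fin n → Fin N, Function.Injective i →
      ∑ κ, p κ * ∏ j, (if κ (i j) = a j then 1 else 0) = q) :
    |∫ x, ∏ j, (x (a j) : ℝ) ∂(empirical p) - q| ≤
      1 - (N.descFactorial n : ℝ) / (N : ℝ) ^ n := by
  classical
  have hN' : (0 : ℝ) < (N : ℝ) ^ n := by positivity
  set m : (Fin n → Fin N) → ℝ := fun i =>
    ∑ κ, p κ * ∏ j, (if κ (i j) = a j then 1 else 0) with hm
  have hm0 : ∀ i, 0 ≤ m i := fun i => Finset.sum_nonneg fun κ _ =>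
    mul_nonneg (hp κ) (Finset.prod_nonneg fun j _ => by split_ifs <;> norm_num)
  have hm1 : ∀ i, m i ≤ 1 := fun i => by
    rw [← hsum]
    refine Finset.sum_le_sum fun κ _ => mul_le_of_le_one_right (hp κ) ?_
    exact Finset.prod_le_one (fun j _ => by split_ifs <;> norm_num)
      (fun j _ => by split_ifs <;> norm_num)
  have hcard : (∑ _i : Fin n → Fin N, (1 : ℝ)) = (N : ℝ) ^ n := by simp
  have hinj : ∑ i : Fin n → Fin N, (if Function.Injective i then (1 : ℝ) else 0) =
      N.descFactorial n := by
    rw [← card_injective, Finset.sum_boole]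
  have hbound : ∀ i, |m i - q| ≤ 1 - if Function.Injective i then (1 : ℝ) else 0 := by
    intro i
    split_ifs with hi
    · simp [hm, h i hi]
    · rw [abs_le]
      constructor <;> linarith [hm0 i, hm1 i]
  rw [integral_empirical_prod hp]
  have : (∑ i, m i) / (N : ℝ) ^ n - q = (∑ i, (m i - q)) / (N : ℝ) ^ n := by
    rw [Finset.sum_sub_distrib, sub_div]
    simp [hN'.ne']
  rw [this, abs_div, abs_of_pos hN', div_le_iff₀ hN', sub_mul, one_mul,
    div_mul_cancel₀ _ hN'.ne']
  calc |∑ i, (m i - q)| ≤ ∑ i, |m i - q| := Finset.abs_sum_le_sum_abs _ _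
    _ ≤ ∑ i : Fin n → Fin N, (1 - if Function.Injective i then (1 : ℝ) else 0) :=
      Finset.sum_le_sum fun i _ => hbound i
    _ = (N : ℝ) ^ n - N.descFactorial n := by rw [Finset.sum_sub_distrib, hcard, hinj]

/-- The de Finetti theorem for a finite alphabet. The marginals of the word distributions are
only compared between positive lengths. -/
theorem exists_probabilityMeasure_of_exchangeable (p : ∀ n, (Fin n → K) → ℝ)
    (hp : ∀ n, 1 ≤ n → ∀ κ, 0 ≤ p n κ) (hsum : ∀ n, 1 ≤ n → ∑ κ, p n κ = 1)
    (hmarg : ∀ n N, 1 ≤ n → ∀ i : Fin n → Fin N, Function.Injective i → ∀ a : Fin n → K,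
      ∑ κ, p N κ * ∏ j, (if κ (i j) = a j then 1 else 0) = p n a) :
    ∃ P : ProbabilityMeasure (K → Set.Icc (0 : ℝ) 1), ∀ n, 1 ≤ n → ∀ a : Fin n → K,
      ∫ x, ∏ j, (x (a j) : ℝ) ∂(P : Measure (K → Set.Icc (0 : ℝ) 1)) = p n a := by
  classical
  -- Length `N + 1` keeps words nonempty, as the hypotheses start at length 1. Probability measures
  -- on the compact cube form a compact space, so an ultrafilter limit replaces the choice of a
  -- subsequence.
  let u : ℕ → ProbabilityMeasure (K → Set.Icc (0 : ℝ) 1) := fun N =>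
    ⟨empirical (p (N + 1)), isProbabilityMeasure_empirical (hp _ (by simp)) (hsum _ (by simp))⟩
  obtain ⟨P, -, hP⟩ := isCompact_univ.ultrafilter_le_nhds ((hyperfilter ℕ).map u) (by simp)
  refine ⟨P, fun n hn a => ?_⟩
  let g : BoundedContinuousFunction (K → Set.Icc (0 : ℝ) 1) ℝ :=
    BoundedContinuousFunction.mkOfCompact ⟨fun x => ∏ j, (x (a j) : ℝ), by fun_prop⟩
  have h1 := (ProbabilityMeasure.tendsto_iff_forall_integral_tendsto.mp
    (show Tendsto u (hyperfilter ℕ) (𝓝 P) from hP)) g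
  have hle : ((hyperfilter ℕ : Ultrafilter ℕ) : Filter ℕ) ≤ atTop := by
    rw [← Nat.cofinite_eq_atTop]
    exact hyperfilter_le_cofinite
  have h2 : Tendsto (fun N => ∫ x, g x ∂(u N : Measure (K → Set.Icc (0 : ℝ) 1))) atTop
      (𝓝 (p n a)) := by
    rw [tendsto_iff_dist_tendsto_zero]
    have h0 : Tendsto (fun N : ℕ => 1 - ((N + 1).descFactorial n : ℝ) / ((N + 1 : ℕ) : ℝ) ^ n)
        atTop (𝓝 0) := by
      simpa using ((tendsto_descFactorial_div_pow n).comp (tendsto_add_atTop_nat 1)).const_sub 1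
    refine squeeze_zero (fun _ => dist_nonneg) (fun N => ?_) h0
    rw [Real.dist_eq]
    refine abs_integral_empirical_prod_sub_le (by simp) (hp _ (by simp)) (hsum _ (by simp))
      (hp n hn a) ?_ fun i hi => hmarg n _ hn i hi a
    rw [← hsum n hn]
    exact Finset.single_le_sum (fun κ _ => hp n hn κ) (Finset.mem_univ a)
  exact tendsto_nhds_unique h1 (h2.mono_left hle)

end ClassicalDeFinetti

/-! ### From extendible operator sequences to exchangeable outcome statistics. -/

section Extendible

variable {T : Type*} [Fintype T] [DecidableEq T]

/-- A sequence of positive operators that is normalised on the products of operators from `𝓜`,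
symmetric, and consistent when the last tensor factor is contracted with an operator from `𝓜`.
The value at `0` plays no role. -/
structure IsExtendibleSeq (𝓜 : Set (Matrix T T ℂ))
    (W : ∀ n : ℕ, Matrix (Fin n → T) (Fin n → T) ℂ) : Prop where
  posSemidef : ∀ n, 1 ≤ n → (W n).PosSemidef
  corr_eq_one : ∀ n, 1 ≤ n → ∀ M : Fin n → Matrix T T ℂ, (∀ j, M j ∈ 𝓜) → corr (W n) M = 1
  symm : ∀ n, 1 ≤ n → ∀ σ : Equiv.Perm (Fin n),
    permOp T σ * W n * (permOp T σ).conjTranspose = W n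
  extend : ∀ n, 1 ≤ n → ∀ M ∈ 𝓜, W n = traceLast (W (n + 1) * onLast n M)

variable {𝓜 : Set (Matrix T T ℂ)} {W : ∀ n : ℕ, Matrix (Fin n → T) (Fin n → T) ℂ}
  {D : Matrix T T ℂ}

theorem IsExtendibleSeq.corr_pad (hW : IsExtendibleSeq 𝓜 W) (hD : D ∈ 𝓜) {n N : ℕ}
    (hn : 1 ≤ n) (hN : n ≤ N) (B : Fin n → Matrix T T ℂ) :
    corr (W N) (fun l => if h : (l : ℕ) < n then B ⟨l, h⟩ else D) = corr (W n) B := by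
  induction N, hN using Nat.le_induction with
  | base => simp
  | succ N hN ih =>
    rw [← ih, hW.extend N (hn.trans hN) D hD, ← corr_snoc]
    congr 1
    funext l
    refine Fin.lastCases ?_ (fun l => ?_) l
    · simp [hN]
    · simp

/-- By symmetry the positions `i` may be moved to the front; the remaining trials, all filled with
`D`, then drop out by `corr_pad`. -/
theorem IsExtendibleSeq.corr_of_injective (hW : IsExtendibleSeq 𝓜 W) (hD : D ∈ 𝓜) {n N : ℕ}
    (hn : 1 ≤ n) {i : Fin n → Fin N} (hi : Function.Injective i) (B : Fin N → Matrix T T ℂ)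
    (hB : ∀ l, l ∉ Set.range i → B l = D) :
    corr (W N) B = corr (W n) (B ∘ i) := by
  have hN : n ≤ N := by simpa using Fintype.card_le_of_injective i hi
  obtain ⟨σ, hσ⟩ := Equiv.Perm.exists_extending_pair (Fin.castLE hN) i
    (Fin.castLE_injective hN) hi
  rw [← corr_comp_perm (hW.symm N (hn.trans hN)) B σ, ← hW.corr_pad hD hn hN]
  congr 1
  funext l
  split_ifs with h
  · simp [← hσ ⟨l, h⟩, Fin.castLE]
  · refine hB _ ?_
    rintro ⟨j, hj⟩
    rw [← hσ j] at hj
    exact h (by simp [← σ.injective hj])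

variable {K : Type*} [Fintype K] {E : K → Matrix T T ℂ}

/-- Measuring every trial with the effects `E` yields an exchangeable sequence of outcomes, whose
directing measure reproduces the correlations of all effects. -/
theorem IsExtendibleSeq.exists_measure (hW : IsExtendibleSeq 𝓜 W)
    (hE : ∀ k, (E k).PosSemidef) (hsum : ∑ k, E k ∈ 𝓜) :
    ∃ P : ProbabilityMeasure (K → Set.Icc (0 : ℝ) 1), ∀ n, 1 ≤ n → ∀ a : Fin n → K,
      ((∫ x, ∏ j, (x (a j) : ℝ) ∂(P : Measure (K → Set.Icc (0 : ℝ) 1)) : ℝ) : ℂ) =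
        corr (W n) (fun j => E (a j)) := by
  classical
  have hnn : ∀ n, 1 ≤ n → ∀ κ : Fin n → K, 0 ≤ corr (W n) fun j => E (κ j) := fun n hn κ =>
    corr_nonneg (hW.posSemidef n hn) fun j => hE _
  have hre : ∀ n, 1 ≤ n → ∀ κ : Fin n → K,
      (((corr (W n) fun j => E (κ j)).re : ℝ) : ℂ) = corr (W n) fun j => E (κ j) :=
    fun n hn κ => (Complex.eq_re_of_ofReal_le (r := 0) (by simpa using hnn n hn κ)).symm
  suffices h : ∃ P : ProbabilityMeasure (K → Set.Icc (0 : ℝ) 1), ∀ n, 1 ≤ n → ∀ a : Fin n → K,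
      ∫ x, ∏ j, (x (a j) : ℝ) ∂(P : Measure (K → Set.Icc (0 : ℝ) 1)) =
        (corr (W n) fun j => E (a j)).re by
    obtain ⟨P, hP⟩ := h
    exact ⟨P, fun n hn a => by rw [hP n hn a, hre n hn]⟩
  refine exists_probabilityMeasure_of_exchangeable
    (fun n κ => (corr (W n) fun j => E (κ j)).re)
    (fun n hn κ => (Complex.nonneg_iff.mp (hnn n hn κ)).1) (fun n hn => ?_)
    (fun n N hn i hi a => ?_)
  · have h := corr_sum_smul (W n) (fun _ _ => 1) E
    simp only [one_smul, Finset.prod_const_one, one_mul] at h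
    rw [hW.corr_eq_one n hn _ fun _ => hsum] at h
    simpa using (congrArg Complex.re h).symm
  -- The coefficients single out outcome `a j` at position `i j` and are all 1 at the other
  -- positions, where the outcomes sum to the element `∑ k, E k` of `𝓜`.
  · have h := corr_sum_smul (W N)
      (fun l k => ∏ j, if i j = l then (if k = a j then 1 else 0) else 1) E
    rw [hW.corr_of_injective hsum hn hi] at h
    · have h1 : ((fun l => ∑ k, (∏ j, if i j = l then (if k = a j then (1 : ℂ) else 0) else 1)
          • E k) ∘ i) = fun j => E (a j) := by
        funext j
        simp [hi.eq_iff]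
      rw [h1] at h
      rw [h, Complex.re_sum]
      refine Finset.sum_congr rfl fun κ _ => ?_
      rw [Finset.prod_comm, mul_comm]
      have h2 : (∏ j, ∏ l, if i j = l then (if κ l = a j then (1 : ℂ) else 0) else 1) =
          ((∏ j, if κ (i j) = a j then (1 : ℝ) else 0 : ℝ) : ℂ) := by
        push_cast
        refine Finset.prod_congr rfl fun j _ => ?_
        split_ifs <;> simp [*]
      rw [h2, Complex.re_ofReal_mul]
    · intro l hl
      refine Finset.sum_congr rfl fun k _ => ?_
      rw [Finset.prod_eq_one, one_smul]
      intro j _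
      exact if_neg fun hj => hl ⟨j, hj⟩

/-- The linear functional `x ↦ ∑ k, f k * x k` on the cube `[0,1]^K`. -/
def evalLin (f : K → ℂ) (x : K → Set.Icc (0 : ℝ) 1) : ℂ := ∑ k, f k * ((x k : ℝ) : ℂ)

theorem continuous_evalLin (f : K → ℂ) : Continuous (evalLin f) := by
  unfold evalLin
  fun_prop

theorem integrable_of_continuous {X F : Type*} [TopologicalSpace X] [CompactSpace X]
    [MeasurableSpace X] [OpensMeasurableSpace X] [NormedAddCommGroup F]
    [SecondCountableTopologyEither X F]
    (P : Measure X) [IsFiniteMeasure P] {g : X → F} (hg : Continuous g) : Integrable g P :=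
  hg.integrable_of_hasCompactSupport (HasCompactSupport.of_compactSpace g)

omit [DecidableEq T] in
-- Both sides are multilinear in `f`, so agreement on the effects extends to their span.
theorem integral_prod_evalLin {P : Measure (K → Set.Icc (0 : ℝ) 1)} [IsFiniteMeasure P] {n : ℕ}
    {V : Matrix (Fin n → T) (Fin n → T) ℂ}
    (hP : ∀ a : Fin n → K, ((∫ x, ∏ j, (x (a j) : ℝ) ∂P : ℝ) : ℂ) = corr V fun j => E (a j))
    (f : Fin n → K → ℂ) :
    ∫ x, ∏ j, evalLin (f j) x ∂P = corr V fun j => ∑ k, f j k • E k := by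
  classical
  rw [corr_sum_smul]
  have h : ∀ x : K → Set.Icc (0 : ℝ) 1, ∏ j, evalLin (f j) x =
      ∑ κ : Fin n → K, (∏ j, f j (κ j)) * ((∏ j, (x (κ j) : ℝ) : ℝ) : ℂ) := by
    intro x
    simp only [evalLin]
    rw [Finset.prod_univ_sum, Fintype.piFinset_univ]
    simp [Finset.prod_mul_distrib]
  simp only [h]
  rw [integral_finsetSum]
  · refine Finset.sum_congr rfl fun κ _ => ?_
    rw [integral_const_mul, integral_complex_ofReal, hP]
  · intro κ _
    refine integrable_of_continuous P ?_
    fun_prop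

end Extendible

/-! ### A spanning family of positive operators, and tests for positivity. -/

section Effects

variable {T : Type*} [Fintype T] [DecidableEq T]

/-- The vector `|i⟩ + I ^ m |j⟩`. -/
noncomputable def polarVec (i j : T) (m : Fin 4) : T → ℂ :=
  Pi.single i 1 + Complex.I ^ (m : ℕ) • Pi.single j 1

/-- The positive operator `v v†` for `v = |i⟩ + I ^ m |j⟩`. -/
noncomputable def polarOp (i j : T) (m : Fin 4) : Matrix T T ℂ :=
  Matrix.vecMulVec (polarVec i j m) (star (polarVec i j m))

theorem posSemidef_polarOp (i j : T) (m : Fin 4) : (polarOp i j m).PosSemidef :=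
  Matrix.posSemidef_vecMulVec_self_star _

theorem polarOp_apply (i j : T) (m : Fin 4) (a b : T) :
    polarOp i j m a b =
      ((if a = i then 1 else 0) + Complex.I ^ (m : ℕ) * (if a = j then 1 else 0)) *
      ((if b = i then 1 else 0) + (-Complex.I) ^ (m : ℕ) * (if b = j then 1 else 0)) := by
  simp [polarOp, polarVec, Matrix.vecMulVec_apply, Pi.single_apply]

/-- The polarization identity. -/
theorem sum_polarOp_smul (i j : T) :
    ∑ m : Fin 4, (Complex.I ^ (m : ℕ) / 4) • polarOp i j m = Matrix.single i j 1 := by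
  ext a b
  have h3 : Complex.I ^ 3 = -Complex.I := by rw [pow_succ, Complex.I_sq]; ring
  have h3' : (-Complex.I) ^ 3 = Complex.I := by rw [neg_pow, h3]; ring
  have h2 : (-Complex.I) ^ 2 = -1 := by rw [neg_sq, Complex.I_sq]
  have hs : Matrix.single i j (1 : ℂ) a b = (if a = i then 1 else 0) * (if b = j then 1 else 0) := by
    simp only [Matrix.single_apply, eq_comm (a := i), eq_comm (a := j), ite_and, ite_mul, one_mul,
      zero_mul]
  simp only [Matrix.sum_apply, Matrix.smul_apply, polarOp_apply, Fin.sum_univ_four, hs,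
    smul_eq_mul]
  simp only [Fin.val_zero, Fin.val_one, Fin.val_two, pow_zero, pow_one, Complex.I_sq, h2,
    show ((3 : Fin 4) : ℕ) = 3 from rfl, h3, h3']
  generalize (if a = i then (1 : ℂ) else 0) = p
  generalize (if a = j then (1 : ℂ) else 0) = q
  generalize (if b = i then (1 : ℂ) else 0) = r
  generalize (if b = j then (1 : ℂ) else 0) = s
  linear_combination ((q * r - p * s) / 2) * Complex.I_sq

/-- The phases `I ^ m` sum to zero, so the cross terms cancel and each pair `i, j` leaves `4 (|i⟩⟨i|
+ |j⟩⟨j|)`. -/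
theorem sum_polarOp :
    ∑ k : T × T × Fin 4, polarOp k.1 k.2.1 k.2.2 =
      (8 * (Fintype.card T : ℂ)) • (1 : Matrix T T ℂ) := by
  have h3 : Complex.I ^ 3 = -Complex.I := by rw [pow_succ, Complex.I_sq]; ring
  have h3' : (-Complex.I) ^ 3 = Complex.I := by rw [neg_pow, h3]; ring
  have h2 : (-Complex.I) ^ 2 = -1 := by rw [neg_sq, Complex.I_sq]
  have hm : ∀ i j a b : T, ∑ m : Fin 4, polarOp i j m a b =
      4 * ((if a = i then 1 else 0) * (if b = i then 1 else 0) +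
        (if a = j then 1 else 0) * (if b = j then 1 else 0)) := by
    intro i j a b
    simp only [polarOp_apply, Fin.sum_univ_four]
    simp only [Fin.val_zero, Fin.val_one, Fin.val_two, pow_zero, pow_one, Complex.I_sq, h2,
      show ((3 : Fin 4) : ℕ) = 3 from rfl, h3, h3']
    generalize (if a = i then (1 : ℂ) else 0) = p
    generalize (if a = j then (1 : ℂ) else 0) = q
    generalize (if b = i then (1 : ℂ) else 0) = r
    generalize (if b = j then (1 : ℂ) else 0) = s
    linear_combination (-2 * q * s) * Complex.I_sq
  ext a b
  simp only [Matrix.sum_apply, Fintype.sum_prod_type, hm, Matrix.smul_apply, Matrix.one_apply,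
    ← Finset.mul_sum, Finset.sum_add_distrib, ite_mul, one_mul, zero_mul]
  simp only [Finset.sum_ite_eq, Finset.mem_univ, if_true, Finset.sum_const, Finset.card_univ,
    nsmul_eq_mul, smul_eq_mul, eq_comm (a := b)]
  simp only [← Finset.mul_sum, Finset.sum_ite_eq, Finset.mem_univ, if_true]
  ring

/-- Finitely many positive operators that span all operators and add up to `c • 1`. -/
theorem exists_spanning_effects [Nonempty T] {c : ℝ} (hc : 0 < c) :
    ∃ (E : T × T × Fin 4 → Matrix T T ℂ) (coef : T → T → T × T × Fin 4 → ℂ),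
      (∀ k, (E k).PosSemidef) ∧ ∑ k, E k = (c : ℂ) • (1 : Matrix T T ℂ) ∧
        ∀ i j, ∑ k, coef i j k • E k = Matrix.single i j 1 := by
  have hD : (0 : ℝ) < 8 * Fintype.card T := by
    have := Fintype.card_pos (α := T)
    positivity
  set d : ℝ := 8 * Fintype.card T with hd
  -- The factor `c / d` turns the total `d • 1` into `c • 1`; the polarization coefficients carry
  -- its inverse.
  refine ⟨fun k => ((c / d : ℝ) : ℂ) • polarOp k.1 k.2.1 k.2.2,
    fun i j k => if k.1 = i then if k.2.1 = j then
      ((d / c : ℝ) : ℂ) * (Complex.I ^ (k.2.2 : ℕ) / 4) else 0 else 0, fun k => ?_, ?_,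
    fun i j => ?_⟩
  · exact (posSemidef_polarOp _ _ _).smul (by rw [Complex.zero_le_real]; positivity)
  · rw [← Finset.smul_sum, sum_polarOp, smul_smul]
    congr 1
    rw [show (8 : ℂ) * (Fintype.card T : ℂ) = (d : ℂ) by simp [hd], ← Complex.ofReal_mul,
      div_mul_cancel₀ _ hD.ne']
  · rw [← sum_polarOp_smul, Fintype.sum_prod_type, Finset.sum_eq_single i]
    · rw [Fintype.sum_prod_type, Finset.sum_eq_single j]
      · refine Finset.sum_congr rfl fun m _ => ?_
        simp only [if_true]
        rw [smul_smul]
        congr 1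
        have : ((d / c : ℝ) : ℂ) * ((c / d : ℝ) : ℂ) = 1 := by
          rw [← Complex.ofReal_mul, div_mul_div_cancel₀ hc.ne', div_self hD.ne',
            Complex.ofReal_one]
        linear_combination (Complex.I ^ (m : ℕ) / 4) * this
      · intro b _ hb
        simp [hb]
      · simp
    · intro b _ hb
      simp [hb]
    · simp

/-- This is the Cauchy–Schwarz inequality. -/
theorem posSemidef_smul_one_sub_vecMulVec (ψ : T → ℂ) :
    (((∑ i, ‖ψ i‖ ^ 2 : ℝ) : ℂ) • (1 : Matrix T T ℂ) -
      Matrix.vecMulVec ψ (star ψ)).PosSemidef := by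
  refine Matrix.PosSemidef.of_dotProduct_mulVec_nonneg ?_ fun φ => ?_
  · refine Matrix.IsHermitian.sub ?_ (Matrix.posSemidef_vecMulVec_self_star ψ).1
    rw [Matrix.IsHermitian, Matrix.conjTranspose_smul, Matrix.conjTranspose_one]
    simp
  · have h1 : star φ ⬝ᵥ ((((∑ i, ‖ψ i‖ ^ 2 : ℝ) : ℂ) • (1 : Matrix T T ℂ) -
        Matrix.vecMulVec ψ (star ψ)).mulVec φ) =
        (((∑ i, ‖ψ i‖ ^ 2) * (∑ i, ‖φ i‖ ^ 2) - ‖star ψ ⬝ᵥ φ‖ ^ 2 : ℝ) : ℂ) := by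
      rw [Matrix.sub_mulVec, Matrix.smul_mulVec, Matrix.one_mulVec, Matrix.vecMulVec_mulVec,
        dotProduct_sub, dotProduct_smul]
      have h2 : star φ ⬝ᵥ φ = ((∑ i, ‖φ i‖ ^ 2 : ℝ) : ℂ) := by
        simp [dotProduct, Complex.conj_mul']
      have h3 : star φ ⬝ᵥ ψ = star (star ψ ⬝ᵥ φ) := by
        simp [dotProduct, mul_comm]
      rw [h2, smul_eq_mul]
      simp only [dotProduct_smul, h3]
      push_cast
      rw [← Complex.mul_conj', mul_comm (star ψ ⬝ᵥ φ)]
      simp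
    rw [h1, Complex.zero_le_real, sub_nonneg]
    have h4 : ‖star ψ ⬝ᵥ φ‖ ≤ ∑ i, ‖ψ i‖ * ‖φ i‖ := by
      refine (norm_sum_le _ _).trans (le_of_eq ?_)
      simp
    exact (pow_le_pow_left₀ (norm_nonneg _) h4 2).trans (Finset.sum_mul_sq_le_sq_mul_sq _ _ _)

/-- Positivity only has to be tested on effects below `c • 1`. -/
theorem posSemidef_of_trace_mul_nonneg {A : Matrix T T ℂ} (hA : A.IsHermitian) {c : ℝ}
    (hc : 0 < c) (h : ∀ B : Matrix T T ℂ, B.PosSemidef →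
      ((c : ℂ) • (1 : Matrix T T ℂ) - B).PosSemidef → 0 ≤ (B * A).trace) :
    A.PosSemidef := by
  refine Matrix.PosSemidef.of_dotProduct_mulVec_nonneg hA fun ψ => ?_
  set N : ℝ := ∑ i, ‖ψ i‖ ^ 2 with hN
  have hN0 : 0 ≤ N := by positivity
  -- Scaling by this factor brings `ψ ψ†` below `c • 1`; the `+ 1` covers `ψ = 0`.
  have hr : 0 < c / (N + 1) := by positivity
  have hr' : (0 : ℂ) ≤ ((c / (N + 1) : ℝ) : ℂ) := by rw [Complex.zero_le_real]; exact hr.le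
  have h1 := h (((c / (N + 1) : ℝ) : ℂ) • Matrix.vecMulVec ψ (star ψ))
    ((Matrix.posSemidef_vecMulVec_self_star ψ).smul hr') ?_
  · rw [Matrix.smul_mul, Matrix.trace_smul, smul_eq_mul, Matrix.vecMulVec_mul,
      Matrix.trace_vecMulVec, dotProduct_comm, ← Matrix.dotProduct_mulVec] at h1
    exact le_of_mul_le_mul_left (by simpa using h1)
      (show (0 : ℂ) < ((c / (N + 1) : ℝ) : ℂ) by rw [Complex.zero_lt_real]; exact hr)
  · have h2 : (c : ℂ) • (1 : Matrix T T ℂ) -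
        ((c / (N + 1) : ℝ) : ℂ) • Matrix.vecMulVec ψ (star ψ) =
        ((c / (N + 1) : ℝ) : ℂ) • (((N : ℂ) • (1 : Matrix T T ℂ) -
          Matrix.vecMulVec ψ (star ψ)) + 1) := by
      have h3 : (c : ℂ) = ((c / (N + 1) : ℝ) : ℂ) * ((N : ℂ) + 1) := by
        rw [← Complex.ofReal_one, ← Complex.ofReal_add, ← Complex.ofReal_mul,
          div_mul_cancel₀ _ (by positivity)]
      conv_lhs => rw [h3]
      module
    rw [h2]
    exact ((posSemidef_smul_one_sub_vecMulVec ψ).add Matrix.PosSemidef.one).smul hr'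

end Effects

/-! ### Almost sure properties of the directing measure, obtained from moments. -/

section AlmostSure

open Filter Topology

/-- By Markov's inequality `r ^ (2n) * P(|g| ≥ r) ≤ 1` for all `n ≥ 1`, which forces the probability
to vanish when `r > 1`. -/
theorem ae_abs_le_one_of_moments {X : Type*} [MeasurableSpace X] {P : Measure X}
    [IsFiniteMeasure P] {g : X → ℝ} (hint : ∀ n : ℕ, Integrable (fun x => g x ^ (2 * n)) P)
    (hg : ∀ n : ℕ, 1 ≤ n → ∫ x, g x ^ (2 * n) ∂P ≤ 1) : ∀ᵐ x ∂P, |g x| ≤ 1 := by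
  have key : ∀ m : ℕ, ∀ᵐ x ∂P, |g x| < 1 + 1 / ((m : ℝ) + 1) := by
    intro m
    set r : ℝ := 1 + 1 / ((m : ℝ) + 1) with hr
    have hr1 : 1 < r := by rw [hr]; exact lt_add_of_pos_right _ (by positivity)
    have hle : ∀ n : ℕ, 1 ≤ n → r ^ (2 * n) * P.real {x | r ≤ |g x|} ≤ 1 := by
      intro n hn
      refine le_trans ?_ ((mul_meas_ge_le_integral_of_nonneg
        (ae_of_all _ fun x => (even_two_mul n).pow_nonneg _) (hint n) (r ^ (2 * n))).trans (hg n hn))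
      refine mul_le_mul_of_nonneg_left (measureReal_mono fun x hx => ?_) (by positivity)
      change r ^ (2 * n) ≤ g x ^ (2 * n)
      rw [← (even_two_mul n).pow_abs (g x)]
      exact pow_le_pow_left₀ (by positivity) hx _
    have hzero : P.real {x | r ≤ |g x|} = 0 := by
      by_contra hne
      have hpos : 0 < P.real {x | r ≤ |g x|} := lt_of_le_of_ne measureReal_nonneg (Ne.symm hne)
      obtain ⟨n, hn⟩ := pow_unbounded_of_one_lt (1 / P.real {x | r ≤ |g x|}) hr1
      have h1 := hle (n + 1) (by simp)
      have h2 : r ^ n ≤ r ^ (2 * (n + 1)) := pow_le_pow_right₀ hr1.le (by omega)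
      rw [div_lt_iff₀ hpos] at hn
      nlinarith
    rw [measureReal_eq_zero_iff] at hzero
    rw [ae_iff]
    simpa using hzero
  filter_upwards [ae_all_iff.mpr key] with x hx
  have h0 : Tendsto (fun m : ℕ => 1 + 1 / ((m : ℝ) + 1)) atTop (𝓝 (1 + 0)) :=
    tendsto_one_div_add_atTop_nhds_zero_nat.const_add 1
  rw [add_zero] at h0
  exact ge_of_tendsto' h0 fun m => (hx m).le

theorem ae_eq_zero_of_integral_mul_conj {X : Type*} [MeasurableSpace X] {P : Measure X}
    {y : X → ℂ} (hint : Integrable (fun x => ‖y x‖ ^ 2) P)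
    (h : ∫ x, y x * (starRingEnd ℂ) (y x) ∂P = 0) : ∀ᵐ x ∂P, y x = 0 := by
  simp only [Complex.mul_conj'] at h
  have h1 : ∫ x, ‖y x‖ ^ 2 ∂P = 0 := by
    have : ∫ x, ((‖y x‖ : ℂ)) ^ 2 ∂P = ((∫ x, ‖y x‖ ^ 2 ∂P : ℝ) : ℂ) := by
      rw [← integral_complex_ofReal]
      simp
    rw [this] at h
    exact_mod_cast h
  rw [integral_eq_zero_iff_of_nonneg (fun x => by positivity) hint] at h1
  filter_upwards [h1] with x hx
  simpa using hx

variable {T : Type*} [Fintype T] [DecidableEq T] {𝓜 : Set (Matrix T T ℂ)}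
  {W : ∀ n : ℕ, Matrix (Fin n → T) (Fin n → T) ℂ} {K : Type*} [Fintype K]
  {E : K → Matrix T T ℂ} {P : Measure (K → Set.Icc (0 : ℝ) 1)}

theorem conj_evalLin (f : K → ℂ) (x : K → Set.Icc (0 : ℝ) 1) :
    (starRingEnd ℂ) (evalLin f x) = evalLin (fun k => (starRingEnd ℂ) (f k)) x := by
  simp [evalLin]

theorem evalLin_sub (f g : K → ℂ) (x : K → Set.Icc (0 : ℝ) 1) :
    evalLin (fun k => f k - g k) x = evalLin f x - evalLin g x := by
  simp [evalLin, sub_mul]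

omit [Fintype T] [DecidableEq T] in
theorem sum_conj_smul (hE : ∀ k, (E k).IsHermitian) (f : K → ℂ) :
    ∑ k, (starRingEnd ℂ) (f k) • E k = (∑ k, f k • E k).conjTranspose := by
  rw [Matrix.conjTranspose_sum]
  refine Finset.sum_congr rfl fun k _ => ?_
  rw [Matrix.conjTranspose_smul, (hE k).eq]
  rfl

/-- `P` reproduces the correlations of the effects `E` in the operators `W`. -/
def Represents (P : Measure (K → Set.Icc (0 : ℝ) 1)) (E : K → Matrix T T ℂ)
    (W : ∀ n : ℕ, Matrix (Fin n → T) (Fin n → T) ℂ) : Prop :=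
  ∀ n, 1 ≤ n → ∀ f : Fin n → K → ℂ,
    ∫ x, ∏ j, evalLin (f j) x ∂P = corr (W n) fun j => ∑ k, f j k • E k

namespace Represents

variable [IsProbabilityMeasure P] (hP : Represents P E W)
include hP

omit [DecidableEq T] [IsProbabilityMeasure P] in
theorem integral_mul (f g : K → ℂ) : ∫ x, evalLin f x * evalLin g x ∂P =
    corr (W 2) ![∑ k, f k • E k, ∑ k, g k • E k] := by
  have h := hP 2 (by simp) ![f, g]
  simp only [Fin.prod_univ_two, Matrix.cons_val_zero, Matrix.cons_val_one] at h
  rw [h]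
  congr 1
  funext j
  fin_cases j <;> rfl

omit [DecidableEq T] in
-- The effects may be linearly dependent, and a point of the cube need not respect their relations.
-- The second absolute moment is a correlation with 0 in one slot, so violations are null.
theorem ae_eq_zero (f : K → ℂ) (hf : ∑ k, f k • E k = 0) : ∀ᵐ x ∂P, evalLin f x = 0 := by
  refine ae_eq_zero_of_integral_mul_conj
    (integrable_of_continuous P ((continuous_evalLin f).norm.pow 2)) ?_
  simp only [conj_evalLin]
  rw [hP.integral_mul]
  exact corr_eq_zero _ (j := 0) hf

omit [DecidableEq T] in
theorem ae_conj_eq (hE : ∀ k, (E k).IsHermitian) (f g : K → ℂ)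
    (hf : (∑ k, f k • E k).conjTranspose = ∑ k, g k • E k) :
    ∀ᵐ x ∂P, (starRingEnd ℂ) (evalLin f x) = evalLin g x := by
  filter_upwards [hP.ae_eq_zero (fun k => (starRingEnd ℂ) (f k) - g k) (by
    simp only [sub_smul, Finset.sum_sub_distrib]
    rw [sum_conj_smul hE, hf, sub_self])] with x hx
  rw [evalLin_sub, sub_eq_zero] at hx
  rw [conj_evalLin, hx]

/-- Normalisation of `W 1` and `W 2` makes the first two moments equal to 1, so the variance is
zero. -/
theorem ae_eq_one (hW : IsExtendibleSeq 𝓜 W) (hE : ∀ k, (E k).IsHermitian) (f : K → ℂ)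
    (hf : ∑ k, f k • E k ∈ 𝓜) (hf' : (∑ k, f k • E k).IsHermitian) :
    ∀ᵐ x ∂P, evalLin f x = 1 := by
  have hc := continuous_evalLin f
  have hreal := hP.ae_conj_eq hE f f hf'
  have h1 : ∫ x, evalLin f x ∂P = 1 := by
    have h := hP 1 le_rfl fun _ => f
    simp only [Finset.univ_unique, Finset.prod_singleton] at h
    rw [h]
    exact hW.corr_eq_one 1 le_rfl _ fun _ => hf
  have h2 : ∫ x, evalLin f x * evalLin f x ∂P = 1 := by
    rw [hP.integral_mul]
    refine hW.corr_eq_one 2 (by simp) _ fun j => ?_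
    fin_cases j <;> exact hf
  have h3 : ∫ x, (evalLin f x - 1) * (starRingEnd ℂ) (evalLin f x - 1) ∂P = 0 := by
    calc ∫ x, (evalLin f x - 1) * (starRingEnd ℂ) (evalLin f x - 1) ∂P
        = ∫ x, (evalLin f x * evalLin f x - 2 * evalLin f x + 1) ∂P := by
          refine integral_congr_ae ?_
          filter_upwards [hreal] with x hx
          rw [map_sub, hx, map_one]
          ring
      _ = 0 := by
          rw [integral_add, integral_sub, h2, integral_const_mul, h1]
          · simp
            norm_num
          all_goals exact integrable_of_continuous P (by fun_prop)
  filter_upwards [ae_eq_zero_of_integral_mul_conj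
    (integrable_of_continuous P (by fun_prop)) h3] with x hx
  exact sub_eq_zero.mp hx

omit hP [IsProbabilityMeasure P] in
-- Expanding `D = B + (D - B)` in every slot writes 1 as a sum of nonnegative correlations, one of
-- which is that of `B` in all slots.
theorem _root_.IsExtendibleSeq.corr_const_le_one (hW : IsExtendibleSeq 𝓜 W) {D B : Matrix T T ℂ}
    (hD : D ∈ 𝓜) (hB : B.PosSemidef) (hDB : (D - B).PosSemidef) {n : ℕ} (hn : 1 ≤ n) :
    corr (W n) (fun _ => B) ≤ 1 := by
  have h := corr_sum_smul (W n) (fun _ _ => 1) ![B, D - B]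
  simp only [one_smul, Finset.prod_const_one, one_mul, Fin.sum_univ_two,
    Matrix.cons_val_zero, Matrix.cons_val_one, add_sub_cancel] at h
  rw [hW.corr_eq_one n hn _ fun _ => hD] at h
  have hpos : ∀ l : Fin 2, (![B, D - B] l).PosSemidef := by
    intro l
    fin_cases l
    · exact hB
    · exact hDB
  have hle := Finset.single_le_sum (f := fun κ : Fin n → Fin 2 => corr (W n) fun j =>
    ![B, D - B] (κ j)) (fun κ _ => corr_nonneg (hW.posSemidef n hn) fun j => hpos (κ j))
    (Finset.mem_univ fun _ => 0)
  rw [← h] at hle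
  exact hle

theorem ae_norm_le_one (hW : IsExtendibleSeq 𝓜 W) (hE : ∀ k, (E k).IsHermitian) {D : Matrix T T ℂ}
    (hD : D ∈ 𝓜) (f : K → ℂ) (hf : (∑ k, f k • E k).PosSemidef)
    (hDf : (D - ∑ k, f k • E k).PosSemidef) :
    ∀ᵐ x ∂P, (starRingEnd ℂ) (evalLin f x) = evalLin f x ∧ |(evalLin f x).re| ≤ 1 := by
  have hc := continuous_evalLin f
  have hreal := hP.ae_conj_eq hE f f hf.1
  refine hreal.and (ae_abs_le_one_of_moments
    (fun n => integrable_of_continuous P (by fun_prop)) fun n hn => ?_)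
  have h1 : ((∫ x, (evalLin f x).re ^ (2 * n) ∂P : ℝ) : ℂ) = corr (W (2 * n)) fun _ =>
      ∑ k, f k • E k := by
    rw [← hP (2 * n) (by omega) fun _ => f, ← integral_complex_ofReal]
    refine integral_congr_ae ?_
    filter_upwards [hreal] with x hx
    have : ((evalLin f x).re : ℂ) = evalLin f x := Complex.conj_eq_iff_re.mp hx
    simp [this]
  have h2 := hW.corr_const_le_one hD hf hDf (show 1 ≤ 2 * n by omega)
  rw [← h1] at h2
  exact_mod_cast h2

/-- The complementary effect has variable `1 - evalLin f x`, which is also at most 1. -/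
theorem ae_nonneg (hW : IsExtendibleSeq 𝓜 W) (hE : ∀ k, (E k).PosSemidef)
    (hsum : ∑ k, E k ∈ 𝓜) (f : K → ℂ) (hf : (∑ k, f k • E k).PosSemidef)
    (hDf : (∑ k, E k - ∑ k, f k • E k).PosSemidef) :
    ∀ᵐ x ∂P, 0 ≤ evalLin f x := by
  have hone : ∑ k, (1 : ℂ) • E k = ∑ k, E k := by simp
  have hsub : ∑ k, ((1 : ℂ) - f k) • E k = ∑ k, E k - ∑ k, f k • E k := by
    simp [sub_smul]
  have hH : (∑ k, E k).IsHermitian := (Matrix.posSemidef_sum _ fun k _ => hE k).1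
  filter_upwards [hP.ae_norm_le_one hW (fun k => (hE k).1) hsum f hf hDf,
    hP.ae_norm_le_one hW (fun k => (hE k).1) hsum (fun k => 1 - f k) (by rwa [hsub])
      (by rw [hsub, sub_sub_cancel]; exact hf),
    hP.ae_eq_one hW (fun k => (hE k).1) (fun _ => 1) (by rwa [hone]) (by rwa [hone])]
    with x h1 h2 h3
  rw [evalLin_sub, h3] at h2
  rw [Complex.nonneg_iff]
  refine ⟨?_, (Complex.conj_eq_iff_im.mp h1.1).symm⟩
  have := (abs_le.mp h2.2).2
  simp only [Complex.sub_re, Complex.one_re] at this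
  linarith

end Represents

end AlmostSure

/-! ### The representing operators and their boundedness. -/

section Representation

open Filter Topology

variable {T : Type*} [Fintype T]

instance : SecondCountableTopology (Matrix T T ℂ) :=
  inferInstanceAs (SecondCountableTopology (T → T → ℂ))

instance : PolishSpace (Matrix T T ℂ) :=
  inferInstanceAs (PolishSpace (T → T → ℂ))

/-- Null sets may be united only countably often; a countable dense part of `𝓑` suffices because the
trace is continuous in `B` and `C` is closed. -/
theorem ae_forall_trace_mul_mem {X : Type*} [MeasurableSpace X] {P : Measure X}
    (A : X → Matrix T T ℂ) (𝓑 : Set (Matrix T T ℂ)) {C : Set ℂ} (hC : IsClosed C)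
    (h : ∀ B ∈ 𝓑, ∀ᵐ x ∂P, (B * A x).trace ∈ C) :
    ∀ᵐ x ∂P, ∀ B ∈ 𝓑, (B * A x).trace ∈ C := by
  obtain ⟨s, hs, hd⟩ := TopologicalSpace.exists_countable_dense 𝓑
  have := (ae_ball_iff hs).mpr fun B _ => h B.1 B.2
  filter_upwards [this] with x hx B hB
  have hcl : IsClosed {B : 𝓑 | ((B : Matrix T T ℂ) * A x).trace ∈ C} :=
    hC.preimage (by fun_prop)
  have hmem : (⟨B, hB⟩ : 𝓑) ∈ closure s := by rw [hd.closure_eq]; trivial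
  exact hcl.closure_subset_iff.mpr hx hmem

theorem isClosed_posSemidef : IsClosed {A : Matrix T T ℂ | A.PosSemidef} := by
  simp only [Matrix.posSemidef_iff_dotProduct_mulVec, Set.ofPred_and, Set.ofPred_forall]
  refine IsClosed.inter (isClosed_eq (by fun_prop) continuous_id) (isClosed_iInter fun φ => ?_)
  exact isClosed_Ici.preimage (f := fun A : Matrix T T ℂ => star φ ⬝ᵥ A.mulVec φ) (by fun_prop)

variable [DecidableEq T]

theorem trace_mul_single (A : Matrix T T ℂ) (i j : T) :
    (Matrix.single i j 1 * A).trace = A j i := by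
  simp [Matrix.trace_single_mul]

theorem sum_smul_sum_coef {K : Type*} [Fintype K] {E : K → Matrix T T ℂ} {coef : T → T → K → ℂ}
    (hcoef : ∀ i j, ∑ k, coef i j k • E k = Matrix.single i j 1) (B : Matrix T T ℂ) :
    ∑ k, (∑ i, ∑ j, B i j * coef i j k) • E k = B := by
  conv_rhs => rw [Matrix.matrix_eq_sum_single B]
  simp only [Finset.sum_smul]
  rw [Finset.sum_comm]
  refine Finset.sum_congr rfl fun i _ => ?_
  rw [Finset.sum_comm]
  refine Finset.sum_congr rfl fun j _ => ?_
  simp only [mul_smul]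
  rw [← Finset.smul_sum, hcoef, Matrix.smul_single, smul_eq_mul, mul_one]

/-- The operator with `tr (E k * A) = x k`, if there is one. -/
def reconstruct {K : Type*} [Fintype K] (coef : T → T → K → ℂ) (x : K → Set.Icc (0 : ℝ) 1) :
    Matrix T T ℂ := fun a b => evalLin (coef b a) x

omit [DecidableEq T] in
-- This holds at every point of the cube, because the matrix units fix one coefficient vector for
-- `B`; the relations among the effects are not needed.
theorem trace_mul_reconstruct {K : Type*} [Fintype K] (coef : T → T → K → ℂ)
    (x : K → Set.Icc (0 : ℝ) 1) (B : Matrix T T ℂ) :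
    (B * reconstruct coef x).trace = evalLin (fun k => ∑ i, ∑ j, B i j * coef i j k) x := by
  simp only [Matrix.trace, Matrix.diag_apply, Matrix.mul_apply, reconstruct, evalLin,
    Finset.mul_sum, Finset.sum_mul, mul_assoc]
  rw [Finset.sum_comm (s := (Finset.univ : Finset K))]
  refine Finset.sum_congr rfl fun i _ => ?_
  rw [Finset.sum_comm]

/-- The de Finetti representation of a symmetric extendible sequence of operators. -/
theorem IsExtendibleSeq.exists_representation [Nonempty T] {𝓜 : Set (Matrix T T ℂ)}
    {W : ∀ n : ℕ, Matrix (Fin n → T) (Fin n → T) ℂ} (hW : IsExtendibleSeq 𝓜 W)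
    (h𝓜 : ∀ M ∈ 𝓜, M.IsHermitian) {c : ℝ} (hc : 0 < c)
    (hD : (c : ℂ) • (1 : Matrix T T ℂ) ∈ 𝓜) :
    ∃ (P : ProbabilityMeasure (T × T × Fin 4 → Set.Icc (0 : ℝ) 1))
      (A : (T × T × Fin 4 → Set.Icc (0 : ℝ) 1) → Matrix T T ℂ), Continuous A ∧
      (∀ᵐ x ∂(P : Measure (T × T × Fin 4 → Set.Icc (0 : ℝ) 1)),
        (A x).PosSemidef ∧ ∀ M ∈ 𝓜, (M * A x).trace = 1) ∧
      ∀ n, 1 ≤ n → ∀ μ ν, W n μ ν = ∫ x, tensorOp (fun _ : Fin n => A x) μ ν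
        ∂(P : Measure (T × T × Fin 4 → Set.Icc (0 : ℝ) 1)) := by
  obtain ⟨E, coef, hE, hsum, hcoef⟩ := exists_spanning_effects (T := T) hc
  have hD' : ∑ k, E k ∈ 𝓜 := by rwa [hsum]
  obtain ⟨P, hP⟩ := hW.exists_measure hE hD'
  have hrep : Represents (P : Measure (T × T × Fin 4 → Set.Icc (0 : ℝ) 1)) E W :=
    fun n hn f => integral_prod_evalLin (hP n hn) f
  refine ⟨P, reconstruct coef, continuous_matrix fun a b => continuous_evalLin _, ?_, ?_⟩
  · have h1 := ae_forall_trace_mul_mem (reconstruct coef) 𝓜 isClosed_singleton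
      (P := (P : Measure (T × T × Fin 4 → Set.Icc (0 : ℝ) 1))) (C := {1}) fun M hM => by
        simp only [trace_mul_reconstruct, Set.mem_singleton_iff]
        exact hrep.ae_eq_one hW (fun k => (hE k).1) _ (by rwa [sum_smul_sum_coef hcoef])
          (by rw [sum_smul_sum_coef hcoef]; exact h𝓜 M hM)
    have h2 := ae_forall_trace_mul_mem (reconstruct coef)
      {B | B.PosSemidef ∧ ((c : ℂ) • (1 : Matrix T T ℂ) - B).PosSemidef} isClosed_Ici
      (P := (P : Measure (T × T × Fin 4 → Set.Icc (0 : ℝ) 1))) (C := Set.Ici 0) fun B hB => by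
        simp only [trace_mul_reconstruct, Set.mem_Ici]
        exact hrep.ae_nonneg hW hE hD' _ (by rw [sum_smul_sum_coef hcoef]; exact hB.1)
          (by rw [sum_smul_sum_coef hcoef, hsum]; exact hB.2)
    -- Hermiticity of the reconstructed operator: `|a⟩⟨b|` and `|b⟩⟨a|` are adjoint.
    have h3 : ∀ᵐ x ∂(P : Measure (T × T × Fin 4 → Set.Icc (0 : ℝ) 1)), ∀ a b : T,
        (starRingEnd ℂ) (evalLin (coef a b) x) = evalLin (coef b a) x := by
      refine ae_all_iff.mpr fun a => ae_all_iff.mpr fun b => ?_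
      refine hrep.ae_conj_eq (fun k => (hE k).1) _ _ ?_
      rw [hcoef, hcoef, Matrix.conjTranspose_single, star_one]
    filter_upwards [h1, h2, h3] with x hx1 hx2 hx3
    refine ⟨posSemidef_of_trace_mul_nonneg ?_ hc fun B hB hB' => hx2 B ⟨hB, hB'⟩,
      fun M hM => hx1 M hM⟩
    ext a b
    exact hx3 a b
  · intro n hn μ ν
    rw [← corr_single (W n)]
    simp only [← hcoef]
    exact (hrep n hn _).symm

/-- A positive operator is bounded in terms of its trace. -/
theorem exists_norm_apply_le [Nonempty T] {c : ℝ} (hc : 0 < c) :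
    ∃ R : ℝ, ∀ A : Matrix T T ℂ, A.PosSemidef →
      (((c : ℂ) • (1 : Matrix T T ℂ)) * A).trace = 1 → ∀ a b, ‖A a b‖ ≤ R := by
  obtain ⟨E, coef, hE, hsum, hcoef⟩ := exists_spanning_effects (T := T) hc
  refine ⟨∑ a, ∑ b, ∑ k, ‖coef b a k‖, fun A hA htr a b => ?_⟩
  have hpos : ∀ k, 0 ≤ (E k * A).trace := fun k => (hE k).trace_mul_nonneg hA
  -- The numbers `tr(E k * A)` form a probability distribution, and the entries of `A` are fixed
  -- linear combinations of them.
  have h1 : ∑ k, ‖(E k * A).trace‖ = 1 := by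
    have h2 : ∀ k, ((‖(E k * A).trace‖ : ℝ) : ℂ) = (E k * A).trace := fun k =>
      RCLike.norm_of_nonneg' (hpos k)
    rw [← Complex.ofReal_inj, Complex.ofReal_sum]
    simp only [h2]
    rw [← Matrix.trace_sum, ← Finset.sum_mul, hsum, htr, Complex.ofReal_one]
  have hle : ∀ k, ‖(E k * A).trace‖ ≤ 1 := fun k => by
    rw [← h1]
    exact Finset.single_le_sum (f := fun k => ‖(E k * A).trace‖) (fun k _ => norm_nonneg _)
      (Finset.mem_univ k)
  have h3 : A a b = ∑ k, coef b a k * (E k * A).trace := by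
    rw [← trace_mul_single A b a, ← hcoef, Finset.sum_mul, Matrix.trace_sum]
    simp
  calc ‖A a b‖ ≤ ∑ k, ‖coef b a k * (E k * A).trace‖ := by rw [h3]; exact norm_sum_le _ _
    _ ≤ ∑ k, ‖coef b a k‖ := Finset.sum_le_sum fun k _ => by
        rw [norm_mul]
        exact mul_le_of_le_one_right (norm_nonneg _) (hle k)
    _ ≤ ∑ b, ∑ k, ‖coef b a k‖ :=
        Finset.single_le_sum (f := fun b => ∑ k, ‖coef b a k‖) (fun b _ => by positivity)
          (Finset.mem_univ b)
    _ ≤ _ := Finset.single_le_sum (f := fun a => ∑ b, ∑ k, ‖coef b a k‖)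
          (fun a _ => by positivity) (Finset.mem_univ a)

end Representation

/-! ### Choi operators of channels and the depolarizing operation. -/

section LocalOperations

/-- Polarization writes a matrix unit through positive operators, whose images are Hermitian; only
positivity of the first ampliation enters. -/
theorem IsCPTP.conjTranspose_map {A B : Type*} [Fintype A] [DecidableEq A] [Fintype B]
    {Φ : Matrix A A ℂ →ₗ[ℂ] Matrix B B ℂ} (hΦ : IsCPTP Φ) (i j : A) :
    (Φ (Matrix.single i j 1)).conjTranspose = Φ (Matrix.single j i 1) := by
  have hH : ∀ X : Matrix A A ℂ, X.PosSemidef → (Φ X).conjTranspose = Φ X := by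
    intro X hX
    have h := hΦ.1 1 (X.submatrix Prod.snd Prod.snd) (hX.submatrix _)
    exact (h.submatrix fun b : B => ((0 : Fin 1), b)).1
  rw [← sum_polarOp_smul i j]
  have h2 : Matrix.single j i (1 : ℂ) = (Matrix.single i j 1).conjTranspose := by
    rw [Matrix.conjTranspose_single, star_one]
  rw [h2, ← sum_polarOp_smul i j, Matrix.conjTranspose_sum, map_sum, map_sum,
    Matrix.conjTranspose_sum]
  refine Finset.sum_congr rfl fun m _ => ?_
  rw [Matrix.conjTranspose_smul, (posSemidef_polarOp i j m).1.eq, map_smul, map_smul,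
    Matrix.conjTranspose_smul, hH _ (posSemidef_polarOp i j m)]

theorem IsCPTP.isHermitian_choi {A B : Type*} [Fintype A] [DecidableEq A] [Fintype B]
    {Φ : Matrix A A ℂ →ₗ[ℂ] Matrix B B ℂ} (hΦ : IsCPTP Φ) : (choi Φ).IsHermitian := by
  ext p q
  have h := congrFun (congrFun (hΦ.conjTranspose_map p.1 q.1) q.2) p.2
  exact h

/-- The completely depolarizing channel. -/
noncomputable def depolarize (A B : Type*) [Fintype A] [Fintype B] [DecidableEq B] :
    Matrix A A ℂ →ₗ[ℂ] Matrix B B ℂ :=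
  (Matrix.traceLinearMap A ℂ ℂ).smulRight (((Fintype.card B : ℂ)⁻¹) • (1 : Matrix B B ℂ))

theorem depolarize_apply {A B : Type*} [Fintype A] [Fintype B] [DecidableEq B]
    (X : Matrix A A ℂ) :
    depolarize A B X = X.trace • ((Fintype.card B : ℂ)⁻¹) • (1 : Matrix B B ℂ) := rfl

theorem isCPTP_depolarize (A B : Type*) [Fintype A] [Fintype B] [DecidableEq B] [Nonempty B] :
    IsCPTP (depolarize A B) := by
  refine ⟨fun k X hX => ?_, fun X => ?_⟩
  -- A Kraus-type form: each diagonal block `X_{aa}` of the traced factor is placed at each basis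
  -- vector `b` of the output.
  · have h : ampliation (Fin k) (depolarize A B) X = ((Fintype.card B : ℂ)⁻¹) •
        ∑ b : B, ∑ a : A,
          (Matrix.diagonal fun p : Fin k × B => if p.2 = b then (1 : ℂ) else 0).conjTranspose *
          X.submatrix (fun p : Fin k × B => (p.1, a)) (fun p : Fin k × B => (p.1, a)) *
          (Matrix.diagonal fun p : Fin k × B => if p.2 = b then (1 : ℂ) else 0) := by
      ext p q
      simp only [ampliation, depolarize_apply, Matrix.trace, Matrix.smul_apply, Matrix.sum_apply,
        Matrix.diagonal_conjTranspose, Matrix.mul_diagonal, Matrix.diagonal_mul,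
        Matrix.submatrix_apply, Matrix.diag_apply, Matrix.of_apply, smul_eq_mul, Pi.star_apply,
        Matrix.one_apply]
      by_cases hpq : p.2 = q.2
      · simp [hpq, mul_comm, apply_ite (star : ℂ → ℂ)]
      · have : ∀ b, (star (if p.2 = b then (1 : ℂ) else 0)) * (if q.2 = b then 1 else 0) = 0 := by
          intro b
          split_ifs with h1 h2 <;> simp_all
        simp only [hpq, if_false, mul_zero]
        symm
        refine mul_eq_zero_of_right _ (Finset.sum_eq_zero fun b _ => Finset.sum_eq_zero
          fun a _ => ?_)
        linear_combination X (p.1, a) (q.1, a) * this b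
    rw [h]
    refine Matrix.PosSemidef.smul (Matrix.posSemidef_sum _ fun b _ => Matrix.posSemidef_sum _
      fun a _ => (hX.submatrix _).conjTranspose_mul_mul_same _) ?_
    rw [← Complex.ofReal_natCast, ← Complex.ofReal_inv, Complex.zero_le_real]
    positivity
  · simp [depolarize_apply, Matrix.trace_smul, Matrix.trace_one]

theorem choi_depolarize (A B : Type*) [Fintype A] [DecidableEq A] [Fintype B] [DecidableEq B] :
    choi (depolarize A B) = ((Fintype.card B : ℂ)⁻¹) • (1 : Matrix (A × B) (A × B) ℂ) := by
  ext p q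
  obtain ⟨p1, p2⟩ := p
  obtain ⟨q1, q2⟩ := q
  simp only [choi, depolarize_apply, Matrix.transpose_apply, Matrix.of_apply, Matrix.smul_apply,
    Matrix.one_apply, Prod.mk.injEq, smul_eq_mul]
  by_cases h1 : p1 = q1 <;> by_cases h2 : p2 = q2 <;>
    simp [h1, h2, Matrix.trace_single_eq_of_ne, Ne.symm]

variable {S : Type*} [Fintype S] (I O : S → Type*)
  [∀ s, Fintype (I s)] [∀ s, Fintype (O s)] [∀ s, DecidableEq (I s)]

theorem isHermitian_of_mem_deterministicOps {M : Matrix (TrialIndex I O) (TrialIndex I O) ℂ}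
    (hM : M ∈ deterministicOps I O) : M.IsHermitian := by
  obtain ⟨Φ, hΦ, rfl⟩ := hM
  exact tensorOp_isHermitian fun s => (hΦ s).isHermitian_choi

variable [DecidableEq S] [∀ s, DecidableEq (O s)] [∀ s, Nonempty (O s)]

/-- This supplies the multiple of the identity that the effects must sum to, and it fixes the trace
of a process matrix. -/
theorem smul_one_mem_deterministicOps :
    (((∏ s, (Fintype.card (O s) : ℝ)⁻¹ : ℝ) : ℂ)) •
      (1 : Matrix (TrialIndex I O) (TrialIndex I O) ℂ) ∈ deterministicOps I O := by
  refine ⟨fun s => depolarize (I s) (O s), fun s => isCPTP_depolarize _ _, ?_⟩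
  simp only [choi_depolarize]
  rw [tensorOp_smul_one]
  push_cast
  rfl

end LocalOperations

/-! ### Process matrices: compactness, mixtures, existence and uniqueness of the measure. -/

section Processes

variable {S : Type*} [Fintype S] [DecidableEq S] (I O : S → Type*)
  [∀ s, Fintype (I s)] [∀ s, Fintype (O s)] [∀ s, DecidableEq (I s)] [∀ s, DecidableEq (O s)]

omit [∀ s, DecidableEq (O s)] in
theorem isClosed_isProcessMatrix :
    IsClosed {W : Matrix (TrialIndex I O) (TrialIndex I O) ℂ | IsProcessMatrix I O W} := by
  simp only [IsProcessMatrix, Set.ofPred_and, Set.ofPred_forall]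
  refine isClosed_posSemidef.inter (isClosed_iInter fun M => isClosed_iInter fun _ => ?_)
  exact isClosed_eq (by fun_prop) continuous_const

theorem isExchangeableSeq_iff_isExtendibleSeq
    (W : ∀ n : ℕ, Matrix (Fin n → TrialIndex I O) (Fin n → TrialIndex I O) ℂ) :
    IsExchangeableSeq I O W ↔ IsExtendibleSeq (deterministicOps I O) W :=
  ⟨fun h => ⟨fun n hn => (h n hn).1.1, fun n hn => (h n hn).1.2, fun n hn => (h n hn).2.1,
    fun n hn => (h n hn).2.2⟩,
  fun h n hn => ⟨⟨h.posSemidef n hn, h.corr_eq_one n hn⟩, h.symm n hn, h.extend n hn⟩⟩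

instance : PolishSpace (ProcessMatrix I O) := (isClosed_isProcessMatrix I O).polishSpace

variable [∀ s, Nonempty (I s)] [∀ s, Nonempty (O s)]

omit [DecidableEq S] [∀ s, DecidableEq (O s)] in
theorem prod_card_inv_pos : (0 : ℝ) < ∏ s, (Fintype.card (O s) : ℝ)⁻¹ :=
  Finset.prod_pos fun s _ => by
    have := Fintype.card_pos (α := O s)
    positivity

instance : CompactSpace (ProcessMatrix I O) := by
  obtain ⟨R, hR⟩ := exists_norm_apply_le (T := TrialIndex I O) (prod_card_inv_pos O)
  have hK : IsCompact (Set.pi Set.univ fun _ : TrialIndex I O => Set.pi Set.univ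
      fun _ : TrialIndex I O => Metric.closedBall (0 : ℂ) R) :=
    isCompact_univ_pi fun _ => isCompact_univ_pi fun _ => isCompact_closedBall _ _
  refine isCompact_iff_compactSpace.mp (hK.of_isClosed_subset (isClosed_isProcessMatrix I O) ?_)
  intro W hW a _ b _
  rw [mem_closedBall_zero_iff]
  exact hR W hW.1 (hW.2 _ (smul_one_mem_deterministicOps I O)) a b

omit [∀ s, DecidableEq (O s)] [∀ s, Nonempty (I s)] [∀ s, Nonempty (O s)] in
theorem continuous_tensorOp_apply {n : ℕ} (μ ν : Fin n → TrialIndex I O) :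
    Continuous fun W : ProcessMatrix I O => tensorOp (fun _ : Fin n => W.1) μ ν := by
  unfold tensorOp
  refine continuous_finsetProd _ fun j _ => ?_
  exact continuous_subtype_val.matrix_elem _ _

variable (P : ProbabilityMeasure (ProcessMatrix I O))

theorem integrable_tensorOp_apply {n : ℕ} (μ ν : Fin n → TrialIndex I O) :
    Integrable (fun W : ProcessMatrix I O => tensorOp (fun _ : Fin n => W.1) μ ν)
      (P : Measure (ProcessMatrix I O)) :=
  integrable_of_continuous _ (continuous_tensorOp_apply I O μ ν)

theorem posSemidef_iidMixture (n : ℕ) : (iidMixture I O P n).PosSemidef := by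
  have hpos : ∀ W : ProcessMatrix I O, (tensorOp fun _ : Fin n => W.1).PosSemidef := fun W =>
    posSemidef_tensorOp fun _ => W.2.1
  refine Matrix.PosSemidef.of_dotProduct_mulVec_nonneg ?_ fun φ => ?_
  · ext μ ν
    refine (integral_conj (𝕜 := ℂ)).symm.trans (integral_congr_ae (ae_of_all _ fun W => ?_))
    exact congrFun (congrFun (hpos W).1 μ) ν
  · have h : star φ ⬝ᵥ (iidMixture I O P n).mulVec φ =
        ∫ W : ProcessMatrix I O, star φ ⬝ᵥ (tensorOp fun _ : Fin n => W.1).mulVec φ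
          ∂(P : Measure (ProcessMatrix I O)) := by
      simp only [dotProduct, Matrix.mulVec, iidMixture]
      have hi : ∀ μ ν, Integrable (fun W : ProcessMatrix I O =>
          tensorOp (fun _ : Fin n => W.1) μ ν * φ ν) (P : Measure (ProcessMatrix I O)) :=
        fun μ ν => (integrable_tensorOp_apply I O P μ ν).mul_const _
      rw [integral_finsetSum _ fun μ _ => (integrable_finsetSum _ fun ν _ => hi μ ν).const_mul _]
      refine Finset.sum_congr rfl fun μ _ => ?_
      rw [integral_const_mul, integral_finsetSum _ fun ν _ => hi μ ν]
      simp only [integral_mul_const]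
    rw [h]
    exact integral_nonneg fun W => (hpos W).dotProduct_mulVec_nonneg φ

theorem corr_iidMixture {n : ℕ} (B : Fin n → Matrix (TrialIndex I O) (TrialIndex I O) ℂ) :
    corr (iidMixture I O P n) B =
      ∫ W : ProcessMatrix I O, ∏ j, (B j * W.1).trace ∂(P : Measure (ProcessMatrix I O)) := by
  have h : ∀ W : ProcessMatrix I O, ∏ j, (B j * W.1).trace =
      ∑ μ, ∑ ν, (∏ j, B j (μ j) (ν j)) * tensorOp (fun _ : Fin n => W.1) ν μ := fun W => by
    rw [← trace_tensorOp, ← tensorOp_mul, ← corr_eq_sum, corr]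
  have hi : ∀ μ ν, Integrable (fun W : ProcessMatrix I O => (∏ j, B j (μ j) (ν j)) *
      tensorOp (fun _ : Fin n => W.1) ν μ) (P : Measure (ProcessMatrix I O)) :=
    fun μ ν => (integrable_tensorOp_apply I O P ν μ).const_mul _
  simp only [h]
  rw [corr_eq_sum, integral_finsetSum _ fun μ _ => integrable_finsetSum _ fun ν _ => hi μ ν]
  refine Finset.sum_congr rfl fun μ _ => ?_
  rw [integral_finsetSum _ fun ν _ => hi μ ν]
  refine Finset.sum_congr rfl fun ν _ => ?_
  rw [integral_const_mul]
  rfl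

omit [∀ s, DecidableEq (O s)] [∀ s, Nonempty (I s)] [∀ s, Nonempty (O s)] in
theorem iidMixture_comp_perm {n : ℕ} (σ : Equiv.Perm (Fin n)) (μ ν : Fin n → TrialIndex I O) :
    iidMixture I O P n (μ ∘ σ) (ν ∘ σ) = iidMixture I O P n μ ν := by
  refine integral_congr_ae (ae_of_all _ fun W => ?_)
  exact Equiv.prod_comp σ fun j => W.1 (μ j) (ν j)

/-- For each `W` the contracted last factor contributes `tr(W M) = 1`. -/
theorem iidMixture_extend {n : ℕ} {M : Matrix (TrialIndex I O) (TrialIndex I O) ℂ}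
    (hM : M ∈ deterministicOps I O) :
    iidMixture I O P n = traceLast (iidMixture I O P (n + 1) * onLast n M) := by
  ext μ ν
  have hW : ∀ W : ProcessMatrix I O, ∑ t, ∑ s, W.1 t s * M s t = 1 := fun W => by
    rw [← W.2.2 M hM, Matrix.trace_mul_comm]
    simp [Matrix.trace, Matrix.mul_apply]
  have hi : ∀ t s, Integrable (fun W : ProcessMatrix I O =>
      tensorOp (fun _ : Fin (n + 1) => W.1) (Fin.snoc (α := fun _ => TrialIndex I O) μ t)
        (Fin.snoc (α := fun _ => TrialIndex I O) ν s) * M s t)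
      (P : Measure (ProcessMatrix I O)) :=
    fun t s => (integrable_tensorOp_apply I O P _ _).mul_const _
  rw [traceLast_mul_onLast_apply]
  simp only [iidMixture, ← integral_mul_const]
  symm
  calc _ = ∑ t, ∫ W : ProcessMatrix I O, ∑ s,
        tensorOp (fun _ : Fin (n + 1) => W.1) (Fin.snoc (α := fun _ => TrialIndex I O) μ t)
          (Fin.snoc (α := fun _ => TrialIndex I O) ν s) * M s t
          ∂(P : Measure (ProcessMatrix I O)) :=
        Finset.sum_congr rfl fun t _ => (integral_finsetSum _ fun s _ => hi t s).symm
    _ = ∫ W : ProcessMatrix I O, ∑ t, ∑ s,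
        tensorOp (fun _ : Fin (n + 1) => W.1) (Fin.snoc (α := fun _ => TrialIndex I O) μ t)
          (Fin.snoc (α := fun _ => TrialIndex I O) ν s) * M s t
          ∂(P : Measure (ProcessMatrix I O)) :=
        (integral_finsetSum _ fun t _ => integrable_finsetSum _ fun s _ => hi t s).symm
    _ = _ := by
        refine integral_congr_ae (ae_of_all _ fun W => ?_)
        change _ = tensorOp (fun _ : Fin n => W.1) μ ν
        rw [← mul_one (tensorOp _ μ ν), ← hW W, Finset.mul_sum]
        refine Finset.sum_congr rfl fun t _ => ?_
        rw [Finset.mul_sum]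
        refine Finset.sum_congr rfl fun s _ => ?_
        simp [tensorOp, Fin.prod_univ_castSucc, mul_assoc]

/-- Mixtures of independent and identical processes are exchangeable. -/
theorem isExchangeableSeq_iidMixture : IsExchangeableSeq I O (iidMixture I O P) := by
  refine fun n _ => ⟨⟨posSemidef_iidMixture I O P n, fun M hM => ?_⟩, fun σ => ?_,
    fun M hM => iidMixture_extend I O P hM⟩
  · change corr _ M = 1
    rw [corr_iidMixture]
    have h : ∀ W : ProcessMatrix I O, ∏ j, (M j * W.1).trace = 1 := fun W =>
      Finset.prod_eq_one fun j _ => W.2.2 _ (hM j)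
    simp [h]
  · ext α β
    have h : ∀ α : Fin n → TrialIndex I O, α = (α ∘ σ.symm) ∘ σ := fun α => by
      funext j
      simp
    rw [h α, h β, permOp_conj_apply]
    exact (iidMixture_comp_perm I O P σ _ _).symm

omit [∀ s, Nonempty (I s)] [∀ s, Nonempty (O s)] in
theorem IsExchangeableSeq.congr
    {V W : ∀ n : ℕ, Matrix (Fin n → TrialIndex I O) (Fin n → TrialIndex I O) ℂ}
    (hV : IsExchangeableSeq I O V) (h : ∀ n, 1 ≤ n → W n = V n) : IsExchangeableSeq I O W := by
  intro n hn
  rw [h n hn, h (n + 1) (by simp)]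
  exact hV n hn

omit [∀ s, DecidableEq (O s)] [∀ s, Nonempty (I s)] [∀ s, Nonempty (O s)] in
/-- A random operator that is almost surely a process matrix has a law on the process matrices. -/
theorem exists_iidMixture_eq_integral {X : Type*} [TopologicalSpace X] [MeasurableSpace X]
    [BorelSpace X] (P : Measure X) [IsProbabilityMeasure P]
    {A : X → Matrix (TrialIndex I O) (TrialIndex I O) ℂ} (hA : Continuous A)
    (hae : ∀ᵐ x ∂P, IsProcessMatrix I O (A x)) :
    ∃ Q : ProbabilityMeasure (ProcessMatrix I O), ∀ (n : ℕ) (μ ν : Fin n → TrialIndex I O),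
      iidMixture I O Q n μ ν = ∫ x, tensorOp (fun _ : Fin n => A x) μ ν ∂P := by
  -- `A` takes values in process matrices only almost everywhere, so the measure is restricted to
  -- this set of full measure before it is pushed forward.
  let G : Set X := {x | IsProcessMatrix I O (A x)}
  have hG : MeasurableSet G := ((isClosed_isProcessMatrix I O).preimage hA).measurableSet
  have hGae : ∀ᵐ x ∂P, x ∈ G := hae
  let g : G → ProcessMatrix I O := fun x => ⟨A x.1, x.2⟩
  have hg : Continuous g := (hA.comp continuous_subtype_val).subtype_mk fun x => x.2
  have hprob : IsProbabilityMeasure (P.comap ((↑) : G → X)) := by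
    constructor
    rw [comap_subtype_coe_apply hG, Set.image_univ, Subtype.range_coe]
    exact (prob_compl_eq_zero_iff hG).mp hGae
  refine ⟨⟨(P.comap ((↑) : G → X)).map g,
    Measure.isProbabilityMeasure_map hg.measurable.aemeasurable⟩, fun n μ ν => ?_⟩
  change ∫ V : ProcessMatrix I O, tensorOp (fun _ : Fin n => V.1) μ ν
    ∂((P.comap ((↑) : G → X)).map g) = _
  rw [integral_map hg.measurable.aemeasurable
    (continuous_tensorOp_apply I O μ ν).aestronglyMeasurable]
  refine (integral_subtype_comap hG fun x : X => tensorOp (fun _ : Fin n => A x) μ ν).trans ?_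
  rw [Measure.restrict_eq_self_of_ae_mem hGae]

/-- Every exchangeable sequence of process matrices is a mixture of independent and identical
processes. -/
theorem IsExchangeableSeq.exists_eq_iidMixture
    {W : ∀ n : ℕ, Matrix (Fin n → TrialIndex I O) (Fin n → TrialIndex I O) ℂ}
    (hW : IsExchangeableSeq I O W) :
    ∃ P : ProbabilityMeasure (ProcessMatrix I O), ∀ n, 1 ≤ n → W n = iidMixture I O P n := by
  obtain ⟨P, A, hA, hae, hP⟩ :=
    ((isExchangeableSeq_iff_isExtendibleSeq I O W).mp hW).exists_representation
      (fun M hM => isHermitian_of_mem_deterministicOps I O hM) (prod_card_inv_pos O)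
      (smul_one_mem_deterministicOps I O)
  obtain ⟨Q, hQ⟩ := exists_iidMixture_eq_integral I O _ hA hae
  refine ⟨Q, fun n hn => ?_⟩
  ext μ ν
  rw [hP n hn, hQ]

/-- A mixing measure is determined by its mixtures. -/
theorem eq_of_iidMixture_eq {P Q : ProbabilityMeasure (ProcessMatrix I O)}
    (h : ∀ n, 1 ≤ n → iidMixture I O P n = iidMixture I O Q n) : P = Q := by
  let e : TrialIndex I O → TrialIndex I O → BoundedContinuousFunction (ProcessMatrix I O) ℂ :=
    fun a b => BoundedContinuousFunction.mkOfCompact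
      ⟨fun W => W.1 a b, continuous_subtype_val.matrix_elem a b⟩
  let s : Set (BoundedContinuousFunction (ProcessMatrix I O) ℂ) := {f | ∃ a b, f = e a b}
  -- Process matrices are Hermitian, so conjugating an entry transposes its indices.
  have hs : star s ⊆ s := by
    rintro f ⟨a, b, hf⟩
    refine ⟨b, a, ?_⟩
    rw [← star_star f, hf]
    ext W
    exact congrFun (congrFun W.2.1.1 b) a
  -- Monomials in the entries of `W` are entries of tensor powers; the degree is the number of
  -- trials.
  have hclosure : ∀ f ∈ Submonoid.closure (s ∪ star s), ∃ (n : ℕ) (μ ν : Fin n → TrialIndex I O),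
      ∀ W : ProcessMatrix I O, f W = tensorOp (fun _ : Fin n => W.1) μ ν := by
    rw [Set.union_eq_self_of_subset_right hs]
    intro f hf
    induction hf using Submonoid.closure_induction with
    | mem f hf =>
      obtain ⟨a, b, rfl⟩ := hf
      exact ⟨1, fun _ => a, fun _ => b, fun W => by simp [tensorOp, e]⟩
    | one => exact ⟨0, finZeroElim, finZeroElim, fun W => by simp [tensorOp]⟩
    | mul f g _ _ hf hg =>
      obtain ⟨n, μ, ν, hf⟩ := hf
      obtain ⟨m, μ', ν', hg⟩ := hg
      refine ⟨n + m, Fin.append μ μ', Fin.append ν ν', fun W => ?_⟩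
      rw [BoundedContinuousFunction.mul_apply, hf, hg]
      simp [tensorOp, Fin.prod_univ_add]
  have hint : ∀ (R : ProbabilityMeasure (ProcessMatrix I O))
      (f : BoundedContinuousFunction (ProcessMatrix I O) ℂ),
      Integrable f (R : Measure (ProcessMatrix I O)) := fun R f =>
    integrable_of_continuous _ f.continuous
  apply Subtype.ext
  change (P : Measure (ProcessMatrix I O)) = (Q : Measure (ProcessMatrix I O))
  refine ext_of_forall_mem_subalgebra_integral_eq_of_polish (𝕜 := ℂ)
    (A := StarAlgebra.adjoin ℂ s) ?_ fun f hf => ?_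
  · intro V W hVW
    obtain ⟨a, b, hab⟩ : ∃ a b, V.1 a b ≠ W.1 a b := by
      by_contra! hne
      exact hVW (Subtype.ext (Matrix.ext hne))
    refine ⟨e a b, ?_, hab⟩
    exact ⟨(e a b).toContinuousMapStarₐ ℂ,
      ⟨e a b, StarAlgebra.subset_adjoin ℂ s ⟨a, b, rfl⟩, rfl⟩, rfl⟩
  · have hf' : f ∈ Submodule.span ℂ
        (Submonoid.closure (s ∪ star s) :
          Set (BoundedContinuousFunction (ProcessMatrix I O) ℂ)) := by
      rw [← StarAlgebra.adjoin_eq_span]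
      exact hf
    clear hf
    induction hf' using Submodule.span_induction with
    | mem f hf =>
      obtain ⟨n, μ, ν, hn⟩ := hclosure f hf
      simp only [hn]
      -- Degree 0 lies outside the hypothesis; there both integrals are total masses, equal to 1.
      rcases Nat.eq_zero_or_pos n with rfl | hpos
      · simp [tensorOp]
      · exact congrFun (congrFun (h n hpos) μ) ν
    | zero => simp
    | add f g _ _ hf hg =>
      simp only [BoundedContinuousFunction.add_apply]
      rw [integral_add (hint P f) (hint P g), integral_add (hint Q f) (hint Q g), hf, hg]
    | smul c f _ hf =>
      simp only [BoundedContinuousFunction.smul_apply, integral_smul, hf]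

end Processes

theorem corollary1 {S : Type*} [Fintype S] [DecidableEq S] (I O : S → Type*)
    [∀ s, Fintype (I s)] [∀ s, Fintype (O s)] [∀ s, DecidableEq (I s)] [∀ s, DecidableEq (O s)]
    [∀ s, Nonempty (I s)] [∀ s, Nonempty (O s)] :
    -- a fixed number of trials
    (∀ (n : ℕ), 1 ≤ n →
      ∀ Wn : Matrix (Fin n → TrialIndex I O) (Fin n → TrialIndex I O) ℂ,
        IsExchangeable I O n Wn ↔
          ∃ P : ProbabilityMeasure (ProcessMatrix I O), Wn = iidMixture I O P n) ∧
    -- the whole sequence, with one measure for all numbers of trials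
    (∀ W : ∀ n : ℕ, Matrix (Fin n → TrialIndex I O) (Fin n → TrialIndex I O) ℂ,
      (IsExchangeableSeq I O W ↔
        ∃ P : ProbabilityMeasure (ProcessMatrix I O), ∀ n, 1 ≤ n → W n = iidMixture I O P n) ∧
      -- the measure is unique
      (IsExchangeableSeq I O W →
        ∃! P : ProbabilityMeasure (ProcessMatrix I O),
          ∀ n, 1 ≤ n → W n = iidMixture I O P n)) := by
  refine ⟨fun n hn Wn => ⟨?_, ?_⟩, fun W => ⟨⟨fun hW => hW.exists_eq_iidMixture, ?_⟩,
    fun hW => ?_⟩⟩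
  · rintro ⟨W, hW, rfl⟩
    obtain ⟨P, hP⟩ := hW.exists_eq_iidMixture
    exact ⟨P, hP n hn⟩
  · rintro ⟨P, rfl⟩
    exact ⟨_, isExchangeableSeq_iidMixture I O P, rfl⟩
  · rintro ⟨P, hP⟩
    exact (isExchangeableSeq_iidMixture I O P).congr I O hP
  · obtain ⟨P, hP⟩ := hW.exists_eq_iidMixture
    exact ⟨P, hP, fun Q hQ => eq_of_iidMixture_eq I O fun n hn =>
      (hQ n hn).symm.trans (hP n hn)⟩
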